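/- Let $g\ge 1$ be an integer, $q>1$ a real number, and let $$P_g(x)=\sum_{k=0}^{g-1}c_k\,(x^{2g-k}+x^k)+c_g x^g$$ with real $\underline c=(c_0,\dots,c_g)$ and $c_0\neq 0$. Let $T=\{z\in\mathbb C: |z|=1\}$. **The vectors $v_g(n)$ and the functions $m_{2g-n}$.** For $k\ge 0$ let $V_k^+$ be the matrix with $\lfloor (k+1)/2\rfloor+1$ rows and $k+1$ columns whose entry in row $r$ and column $j$ (both numbered from $0$) is $1$ if $j=r$ or $j+r=k+1$, and $0$ otherwise; let $V_k^-$ be the matrix with $\lfloor k/2\rfloor+1$ rows and $k+1$ columns whose entry is $1$ if $j=r$, $-1$ if $j+r=k+1$, and $0$ otherwise; let $W_k^\pm$ be given by the same rules with $k+2$ columns. Put $$P_k(m)=\begin{bmatrix}V_k^+&0\\0&V_k^-\\ [\,0\ I_k\,]&-m[\,0\ I_k\,]\end{bmatrix},\qquad Q_k=\begin{bmatrix}W_k^+&0\\0&W_k^-\\0&0\end{bmatrix},$$ of sizes $(2k+2)\times(2k+2)$ and $(2k+2)\times(2k+4)$, where $[\,0\ I_k\,]$ is $I_k$ preceded by a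 zero column. Regard $c_0,\dots,c_g$ and $\log q$ as indeterminates. Let $v_g(0)$ be the vector of length $4g+2$ with entries $\gamma_0,\dots,\gamma_{2g},\ \gamma_0 g\log q,\ \gamma_1(g-1)\log q,\dots,\gamma_{2g}(-g)\log q$, where $\gamma_i=c_{\min(i,2g-i)}$, and for $1\le n\le 2g$ define recursively over $\mathbb Q(c_0,\dots,c_g,\log q)$ (with $v[j]$ the $j$-th entry of $v$, $j\ge1$) $$m_{2g-n}=\frac{v_g(n-1)[1]+v_g(n-1)[2g-n+2]}{v_g(n-1)[2g-n+3]-v_g(n-1)[4g-2n+4]},\qquad v_g(n)=P_{2g-n}(m_{2g-n})^{-1}Q_{2g-n}\,v_g(n-1).$$ **The system.** For $q^{(n-1)/2}\le a<q^{n/2}$, $1\le n\le 2g$, put $$m_q(a)=m_{2g-n},\qquad H_q(a)=\begin{bmatrix}m_q(a)^{-1}&0\\0&m_q(a)\end{bmatrix},$$ $$A_q(a,z)=\frac12\sum_{i=0}^{2g-n}\Big(\big(\tfrac{q^{g-i}}{a}\big)^{iz}+\big(\tfrac{q^{g-i}}{a}\big)^{-iz}\Big)v_g(n)[i+1],$$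 $$B_q(a,z)=\frac{-i}{2}\sum_{i=0}^{2g-n}\Big(\big(\tfrac{q^{g-i}}{a}\big)^{iz}-\big(\tfrac{q^{g-i}}{a}\big)^{-iz}\Big)v_g(n)[2g-n+2+i]$$ (in the exponents $iz$ and in the factor $-i$, $i$ is the imaginary unit; elsewhere it is the summation index), where the real numbers $\underline c$ and $\log q$ are substituted into the rational functions $m_q(a)^{-1}$, $m_q(a)$ and $v_g(n)[j]$; $H_q(a)$ is defined at $a$ if the substitution gives finite values for all its entries, i.e. if $m_{2g-n}$ and $m_{2g-n}^{-1}$ both have finite values at $(\underline c,\log q)$. Finally let $$A_q(z)=q^{-giz}P_g(q^{iz}),\qquad B_q(z)=-A_q'(z),\qquad E_q(z)=A_q(z)-iB_q(z).$$ A matrix-valued function $H$ defines a *canonical system* on $[a_1,a_0)$ if it is defined almost everywhere on $[a_1,a_0)$ and (H1) $H(a)$ is a real symmetric positive semidefinite $2\times2$ matrix for almost every $a$, (H2) $H$ does not vanish almost everywhere on any relatively open subset of $[a_1,a_0)$ of positive Lebesgue measure, (H3) $H$ is locally integrable on $[a_1,a_0)$. A *solution* of the canonical system is a pair $(A(a,z),B(a,z))$,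 locally absolutely continuous in $a\in[a_1,a_0)$ for every $z\in\mathbb C$, such that for every $z\in\mathbb{C}$ $$-a\frac{\partial}{\partial a}\begin{bmatrix}A(a,z)\\B(a,z)\end{bmatrix}=z\begin{bmatrix}0&-1\\1&0\end{bmatrix}H(a)\begin{bmatrix}A(a,z)\\B(a,z)\end{bmatrix}\ \text{ for almost every } a,\qquad \lim_{a\to a_0^-}\begin{bmatrix}A(a,z)\\B(a,z)\end{bmatrix}=\begin{bmatrix}1\\0\end{bmatrix}.$$ **Statement.** $H_q(a)$ defines a canonical system on $[1,q^g)$ if and only if all zeros of $P_g(x)$ lie on $T$ and are simple. If $H_q(a)$ defines a canonical system on $[1,q^g)$, then $E_q(0)\ne0$, the functions $A_q(a,z)$ and $B_q(a,z)$ are defined for all $a\in[1,q^g)$ (all entries of $v_g(1),\dots,v_g(2g)$ have finite values), and the pair $\big(A_q(a,z)/E_q(0),\,B_q(a,z)/E_q(0)\big)$ is a solution of the canonical system. -/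

import Mathlib

open MeasureTheory Set Filter Topology

noncomputable section

namespace SelfReciprocal

/-! ### Canonical systems of ordinary linear differential equations -/

/-- `H`, a function with values in the real `2 × 2` matrices which is defined at the points of `D`
(its values at other points carry no information), defines a canonical system on the finite
interval `[a₁, a₀)`. -/
structure IsCanonicalSystem (D : Set ℝ) (H : ℝ → Matrix (Fin 2) (Fin 2) ℝ) (a₁ a₀ : ℝ) :
    Prop where
  lt : a₁ < a₀
  /-- `H` is defined almost everywhere on the interval. -/
  ae_defined : ∀ᵐ a ∂(volume.restrict (Ico a₁ a₀)), a ∈ D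
  /-- `H` is symmetric and positive semidefinite almost everywhere. -/
  ae_posSemidef : ∀ᵐ a ∂(volume.restrict (Ico a₁ a₀)), (H a).PosSemidef
  /-- `H` does not vanish (almost everywhere) on a relatively open subset of the interval
  with positive Lebesgue measure. -/
  not_ae_zero : ∀ U : Set ℝ, IsOpen U → 0 < volume (U ∩ Ico a₁ a₀) →
    ¬ ∀ᵐ a ∂(volume.restrict (U ∩ Ico a₁ a₀)), H a = 0
  /-- `H` is locally integrable on the interval. -/
  locallyIntegrable : ∀ i j, LocallyIntegrableOn (fun a => H a i j) (Ico a₁ a₀) volume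

/-- `Y a z = (A(a,z), B(a,z))` is a solution on `[a₁, a₀)` of the system
`-a ∂/∂a Y(a,z) = z [0 -1; 1 0] H(a) Y(a,z)`, `lim_{a → a₀⁻} Y(a,z) = (1,0)`: for every complex
`z` it is locally absolutely continuous in `a`, satisfies the equation for almost every `a`, and
satisfies the boundary condition. -/
structure IsSolution (H : ℝ → Matrix (Fin 2) (Fin 2) ℝ) (a₁ a₀ : ℝ)
    (Y : ℝ → ℂ → (Fin 2 → ℂ)) : Prop where
  absolutelyContinuous : ∀ z : ℂ, ∀ b ∈ Ico a₁ a₀,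
    AbsolutelyContinuousOnInterval (fun a => Y a z) a₁ b
  equation : ∀ z : ℂ, ∀ᵐ a ∂(volume.restrict (Ico a₁ a₀)), ∃ Y' : Fin 2 → ℂ,
    HasDerivAt (fun t => Y t z) Y' a ∧
    -(a : ℂ) • Y' = z • ((!![0, -1; 1, 0] * (H a).map Complex.ofReal).mulVec (Y a z))
  boundary : ∀ z : ℂ, Tendsto (fun a => Y a z) (𝓝[<] a₀) (𝓝 ![1, 0])

/-! ### The linear system over a field

Vectors are functions on `ℕ`, and the entry with number `j = 1, 2, …` is the value at `j - 1`. -/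

section LinearSystem

variable {F : Type*} [Field F]

/-- Entries of `V_k^+` and, with one more column, of `W_k^+` (rows and columns from `0`). -/
def plusEntry (F : Type*) [Field F] (k r j : ℕ) : F :=
  if j = r ∨ j + r = k + 1 then 1 else 0

/-- Entries of `V_k^-` and, with one more column, of `W_k^-` (rows and columns from `0`). -/
def minusEntry (F : Type*) [Field F] (k r j : ℕ) : F :=
  if j = r then 1 else if j + r = k + 1 then -1 else 0

/-- Number of rows of `V_k^+` and `W_k^+`: `(k+3)/2` for odd `k`, `(k+2)/2` for even `k`.
The matrices `V_k^-` and `W_k^-` have `k + 2 - plusRows k` rows: `(k+1)/2` for odd `k`, `(k+2)/2`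
for even `k`. -/
def plusRows (k : ℕ) : ℕ := (k + 1) / 2 + 1

/-- The matrix `P_k(m)` with the block rows `[V_k^+, 0]`, `[0, V_k^-]`,
`[0 I_k, -m • 0 I_k]`, where `0 I_k` is `I_k` preceded by a zero column. -/
def matP (k : ℕ) (m : F) : Matrix (Fin (2 * k + 2)) (Fin (2 * k + 2)) F := fun i j =>
  if (i : ℕ) < plusRows k then
    if (j : ℕ) < k + 1 then plusEntry F k i j else 0
  else if (i : ℕ) < k + 2 then
    if (j : ℕ) < k + 1 then 0 else minusEntry F k (i - plusRows k) (j - (k + 1))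
  else
    if (j : ℕ) < k + 1 then (if (j : ℕ) = i - (k + 2) + 1 then 1 else 0)
    else (if (j : ℕ) - (k + 1) = i - (k + 2) + 1 then -m else 0)

/-- The matrix `Q_k` with the block rows `[W_k^+, 0]`, `[0, W_k^-]`, `[0, 0]`. -/
def matQ (F : Type*) [Field F] (k : ℕ) : Matrix (Fin (2 * k + 2)) (Fin (2 * k + 4)) F := fun i j =>
  if (i : ℕ) < plusRows k then
    if (j : ℕ) < k + 2 then plusEntry F k i j else 0
  else if (i : ℕ) < k + 2 then
    if (j : ℕ) < k + 2 then 0 else minusEntry F k (i - plusRows k) (j - (k + 2))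
  else 0

/-- `m_k`, computed from the preceding vector `w` of length `2k + 4`. -/
def mOf (k : ℕ) (w : ℕ → F) : F :=
  (w 0 + w (k + 1)) / (w (k + 2) - w (2 * k + 3))

/-- The vector `P_k(m_k)⁻¹ Q_k w` of length `2k + 2`, computed from the preceding vector `w` of
length `2k + 4`. -/
def stepVec (k : ℕ) (w : ℕ → F) : ℕ → F := fun j =>
  if h : j < 2 * k + 2 then
    ((matP k (mOf k w))⁻¹.mulVec ((matQ F k).mulVec fun i => w i)) ⟨j, h⟩
  else 0

/-- The vectors `v_g(0), v_g(1), …, v_g(2g)` with initial vector `w`. -/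
def vSeq (g : ℕ) (w : ℕ → F) : ℕ → ℕ → F
  | 0 => w
  | n + 1 => stepVec (2 * g - (n + 1)) (vSeq g w n)

/-- `m_{2g-n}` for `1 ≤ n ≤ 2g`, with initial vector `w`. -/
def mSeq (g : ℕ) (w : ℕ → F) (n : ℕ) : F :=
  mOf (2 * g - n) (vSeq g w (n - 1))

end LinearSystem

/-! ### Rational functions of the coefficients and of `log q` -/

/-- Polynomials over `ℚ` in the indeterminates `c_0, …, c_g` (`some k`) and `log q` (`none`). -/
abbrev Poly (g : ℕ) : Type := MvPolynomial (Option (Fin (g + 1))) ℚ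

/-- The field `ℚ(c_0, …, c_g, log q)`. -/
abbrev RatFun (g : ℕ) : Type := FractionRing (Poly g)

/-- `y` is the value at `x` of the rational function `f`: `f` can be written as a quotient of
polynomials whose denominator does not vanish at `x`, and `y` is the value of that quotient. -/
def IsValueAt {g : ℕ} (x : Option (Fin (g + 1)) → ℝ) (f : RatFun g) (y : ℝ) : Prop :=
  ∃ p d : Poly g, MvPolynomial.aeval x d ≠ 0 ∧
    f = algebraMap (Poly g) (RatFun g) p / algebraMap (Poly g) (RatFun g) d ∧
    y = MvPolynomial.aeval x p / MvPolynomial.aeval x d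

/-- Substitution of `x` into `f` gives a (finite) number. -/
def DefinedAt {g : ℕ} (x : Option (Fin (g + 1)) → ℝ) (f : RatFun g) : Prop :=
  ∃ y, IsValueAt x f y

open Classical in
/-- The value of `f` at `x` (and `0` if `f` is not defined at `x`). -/
def valueAt {g : ℕ} (x : Option (Fin (g + 1)) → ℝ) (f : RatFun g) : ℝ :=
  if h : DefinedAt x f then h.choose else 0

theorem IsValueAt.unique {g : ℕ} {x : Option (Fin (g + 1)) → ℝ} {f : RatFun g} {y y' : ℝ}
    (h : IsValueAt x f y) (h' : IsValueAt x f y') : y = y' := by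
  obtain ⟨p, d, hd, hf, rfl⟩ := h
  obtain ⟨p', d', hd', hf', rfl⟩ := h'
  have hd0 : d ≠ 0 := by rintro rfl; simp at hd
  have hd0' : d' ≠ 0 := by rintro rfl; simp at hd'
  have inj := IsFractionRing.injective (Poly g) (RatFun g)
  have e1 : algebraMap (Poly g) (RatFun g) d ≠ 0 := by
    rwa [Ne, map_eq_zero_iff _ inj]
  have e2 : algebraMap (Poly g) (RatFun g) d' ≠ 0 := by
    rwa [Ne, map_eq_zero_iff _ inj]
  rw [hf, div_eq_div_iff e1 e2, ← map_mul, ← map_mul] at hf'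
  have := congrArg (MvPolynomial.aeval x) (inj hf')
  rw [map_mul, map_mul] at this
  rw [div_eq_div_iff hd hd']
  exact this

theorem IsValueAt.valueAt_eq {g : ℕ} {x : Option (Fin (g + 1)) → ℝ} {f : RatFun g} {y : ℝ}
    (h : IsValueAt x f y) : valueAt x f = y := by
  have hd : DefinedAt x f := ⟨y, h⟩
  rw [valueAt, dif_pos hd]
  exact hd.choose_spec.unique h

/-- The coefficient `c_{min(i, 2g-i)}` of `x^{2g-i}` in the self-reciprocal polynomial, as an
indeterminate. -/
def coeffVar (g i : ℕ) : RatFun g :=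
  algebraMap (Poly g) (RatFun g)
    (MvPolynomial.X (some ⟨min i (2 * g - i), by omega⟩))

/-- `log q` as an indeterminate. -/
def logVar (g : ℕ) : RatFun g :=
  algebraMap (Poly g) (RatFun g) (MvPolynomial.X none)

/-- The initial vector `v_g(0)`: the coefficients, followed by the products of the coefficient of
`x^{2g-i}` with `log (q^{g-i}) = (g-i) log q`, for `i = 0, …, 2g`. -/
def initVec (g : ℕ) : ℕ → RatFun g := fun j =>
  if j < 2 * g + 1 then coeffVar g j
  else if j < 4 * g + 2 then
    coeffVar g (j - (2 * g + 1)) * (((g : RatFun g) - ((j - (2 * g + 1) : ℕ) : RatFun g)) * logVar g)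
  else 0

/-- The vector `v_g(n)` over the field of rational functions. -/
def vVec (g n : ℕ) : ℕ → RatFun g := vSeq g (initVec g) n

/-- `m_{2g-n}(c; log q)` as a rational function, for `1 ≤ n ≤ 2g`. -/
def mRat (g n : ℕ) : RatFun g := mSeq g (initVec g) n

/-- The number `n` with `q^{(n-1)/2} ≤ a < q^{n/2}`, for `a ≥ 1`. -/
def stepIndex (q a : ℝ) : ℕ := ⌊2 * Real.logb q a⌋₊ + 1

theorem stepIndex_eq_iff {q a : ℝ} (hq : 1 < q) (ha : 1 ≤ a) (n : ℕ) :
    stepIndex q a = n ↔ q ^ (((n : ℝ) - 1) / 2) ≤ a ∧ a < q ^ ((n : ℝ) / 2) := by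
  have h0 : 0 ≤ 2 * Real.logb q a := by
    have := Real.logb_nonneg hq ha
    linarith
  have ha' : 0 < a := by linarith
  rw [← Real.le_logb_iff_rpow_le hq ha', ← Real.logb_lt_iff_lt_rpow hq ha', stepIndex]
  rcases n with _ | n
  · have h1 := Real.logb_nonneg hq ha
    simp
    intro _
    exact h1
  · rw [Nat.add_right_cancel_iff, Nat.floor_eq_iff h0]
    push_cast
    constructor <;> rintro ⟨h1, h2⟩ <;> constructor <;> linarith

/-- The matrix `diag(m_q(a)⁻¹, m_q(a))` over the field of rational functions. -/
def hMatrix (g : ℕ) (q a : ℝ) : Matrix (Fin 2) (Fin 2) (RatFun g) :=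
  !![(mRat g (stepIndex q a))⁻¹, 0; 0, mRat g (stepIndex q a)]

/-! ### Substitution of numerical coefficients -/

/-- The point at which rational functions are evaluated: real coefficients `c` and the real number
`log q`. -/
def point {g : ℕ} (c : Fin (g + 1) → ℝ) (q : ℝ) : Option (Fin (g + 1)) → ℝ :=
  fun o => o.elim (Real.log q) c

/-- The matrix `H_q(a)` attached to the real coefficients `c`. -/
def hamiltonian {g : ℕ} (c : Fin (g + 1) → ℝ) (q a : ℝ) : Matrix (Fin 2) (Fin 2) ℝ :=
  (hMatrix g q a).map (valueAt (point c q))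

/-- The points of `[1, q^g)` at which `H_q` is defined: every entry has a finite value. -/
def hamiltonianDomain {g : ℕ} (c : Fin (g + 1) → ℝ) (q : ℝ) : Set ℝ :=
  {a | a ∈ Ico 1 (q ^ g) ∧ ∀ i j, DefinedAt (point c q) (hMatrix g q a i j)}

/-- `(q^k / a)^{iz}`. -/
def expFun (q a : ℝ) (k : ℤ) (z : ℂ) : ℂ := ((q ^ k / a : ℝ) : ℂ) ^ (Complex.I * z)

/-- `c_k(a,z) = (q^k / a)^{iz} + (q^k / a)^{-iz}`. -/
def cFun (q a : ℝ) (k : ℤ) (z : ℂ) : ℂ := expFun q a k z + expFun q a k (-z)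

/-- `s_k(a,z) = (q^k / a)^{iz} - (q^k / a)^{-iz}`. -/
def sFun (q a : ℝ) (k : ℤ) (z : ℂ) : ℂ := expFun q a k z - expFun q a k (-z)

/-- The pair `(A_q(a,z), B_q(a,z)) = 1/2 diag(1, -i) T_n(a,z) v_g(n)` for
`q^{(n-1)/2} ≤ a < q^{n/2}`, where `T_n(a,z)` has the rows
`(c_g(a,z), c_{g-1}(a,z), …, c_{-g+n}(a,z), 0, …, 0)` and
`(0, …, 0, s_g(a,z), s_{g-1}(a,z), …, s_{-g+n}(a,z))`. -/
def abPair {g : ℕ} (c : Fin (g + 1) → ℝ) (q a : ℝ) (z : ℂ) : Fin 2 → ℂ :=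
  let n := stepIndex q a
  let l := 2 * g - n + 1
  let v : ℕ → ℂ := fun j => (valueAt (point c q) (vVec g n j) : ℂ)
  ![1 / 2 * ∑ i ∈ Finset.range l, cFun q a ((g : ℤ) - i) z * v i,
    1 / 2 * (-Complex.I) * ∑ i ∈ Finset.range l, sFun q a ((g : ℤ) - i) z * v (l + i)]

/-- `A_q(a,z)` and `B_q(a,z)` are defined at `a`: every entry of the vector `v_g(n)` (of length
`4g - 2n + 2`) has a finite value. -/
def abDefined {g : ℕ} (c : Fin (g + 1) → ℝ) (q a : ℝ) : Prop :=
  ∀ j < 4 * g - 2 * stepIndex q a + 2, DefinedAt (point c q) (vVec g (stepIndex q a) j)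

/-! ### The self-reciprocal polynomial and the functions attached to it -/

/-- `P_g(x) = ∑_{k=0}^{g-1} c_k (x^{2g-k} + x^k) + c_g x^g`, as a complex polynomial. -/
def selfRecipPoly {g : ℕ} (c : Fin (g + 1) → ℝ) : Polynomial ℂ :=
  ∑ k : Fin g, Polynomial.C (c k.castSucc : ℂ) *
      (Polynomial.X ^ (2 * g - (k : ℕ)) + Polynomial.X ^ (k : ℕ)) +
    Polynomial.C (c (Fin.last g) : ℂ) * Polynomial.X ^ g

/-- `A_q(z) = q^{-giz} P_g(q^{iz})`. -/
def aFun {g : ℕ} (c : Fin (g + 1) → ℝ) (q : ℝ) (z : ℂ) : ℂ :=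
  (q : ℂ) ^ (-((g : ℂ) * Complex.I * z)) *
    (selfRecipPoly c).eval ((q : ℂ) ^ (Complex.I * z))

/-- `B_q(z) = -A_q'(z)`. -/
def bFun {g : ℕ} (c : Fin (g + 1) → ℝ) (q : ℝ) (z : ℂ) : ℂ := -deriv (aFun c q) z

/-- `E_q(z) = A_q(z) - i B_q(z)`. -/
def eFun {g : ℕ} (c : Fin (g + 1) → ℝ) (q : ℝ) (z : ℂ) : ℂ :=
  aFun c q z - Complex.I * bFun c q z

end SelfReciprocal

end

noncomputable section

namespace SelfReciprocal

/-! ### Solving the linear system -/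

section LinearSystem

variable {F : Type*} [Field F]

/-! The recursion for `v_g(n)` is the Schur–Cohn algorithm applied to the derivative `P_g'`.

Algebra. As long as the `m`'s are nonzero, the linear system can be solved explicitly, and for `n ≥
1` the solution has the shape `v_g(n) = (m b, b)` with `m = m_{2g-n}` (`stepVec_eq`). With `K = 2g -
n` and `ρ = m_{2g-n} / m_{2g-n-1}`, the defining formula for `m` becomes `ρ = (b_0 - b_K) / (b_0 +
b_K)`, and the passage from `b` to the next vector is `schurStep`: it replaces the polynomial `b` by
a combination of `b` and its reversal whose last coefficient vanishes, divided by `x`. The first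
vector `b` lists the coefficients of `log q · P_g'`.

Equivalence. For `ρ > 0` a Schur–Cohn step preserves and reflects stability, i.e. having all zeros
in the open unit disc (`stable_schurStep_iff`), and stability forces `|b_K| < |b_0|`, which gives `ρ
> 0`. Since `m_{2g-1}` has the positive value `1 / (g log q)`, all `m`'s are positive exactly when
`P_g'` is stable (`mVal_pos_iff_stable`). This is equivalent to `P_g` having only simple zeros on
the unit circle (`roots_on_circle_iff_stable`), by the logarithmic derivative in one direction and
by `2g P = x P' + (P')*` in the other, where `*` is reversal. Finally, as `H_q` is constant on each
interval, positivity of all `m`'s is what the canonical system axioms amount to.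

Solution. On each interval the pair `(A_q, B_q)` satisfies the equation because of the shape `(m b,
b)` (`hasDerivAt_piece`). The rows `V^± = W^±` of the linear system say that neighbouring pieces
agree at the breakpoints (`Regular.piece_succ_eq`). At `a = q^g` only a constant is left, and it
equals `E_q(0)`. -/

theorem matP_mulVec (k : ℕ) (m : F) (u : ℕ → F) (i : Fin (2 * k + 2)) :
    (matP k m).mulVec (fun j => u j) i =
      if (i : ℕ) < plusRows k then ∑ j ∈ Finset.range (k + 1), plusEntry F k i j * u j
      else if (i : ℕ) < k + 2 then
        ∑ j ∈ Finset.range (k + 1), minusEntry F k (i - plusRows k) j * u (k + 1 + j)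
      else u (i - (k + 2) + 1) - m * u (k + 1 + (i - (k + 2) + 1)) := by
  obtain ⟨i, hi⟩ := i
  have key : ∀ f : ℕ → F, ∑ j : Fin (2 * k + 2), f j =
      ∑ j ∈ Finset.range (k + 1), f j + ∑ j ∈ Finset.range (k + 1), f (k + 1 + j) := by
    intro f
    rw [Fin.sum_univ_eq_sum_range, show 2 * k + 2 = (k + 1) + (k + 1) by ring,
      Finset.sum_range_add]
  have hlt : ∀ j, ¬ (k + 1 + j < k + 1) := fun j => by omega
  have hsub : ∀ j, k + 1 + j - (k + 1) = j := fun j => by omega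
  have hlt' : ∀ j ∈ Finset.range (k + 1), j < k + 1 := fun j hj => Finset.mem_range.1 hj
  simp only [Matrix.mulVec, dotProduct, matP]
  split_ifs with h1 h2
  · rw [key (fun j => (if j < k + 1 then plusEntry F k i j else 0) * u j)]
    simp only [hlt, if_false, zero_mul, Finset.sum_const_zero, add_zero]
    exact Finset.sum_congr rfl fun j hj => by rw [if_pos (hlt' j hj)]
  · rw [key (fun j => (if j < k + 1 then 0 else
      minusEntry F k (i - plusRows k) (j - (k + 1))) * u j)]
    simp only [hlt, if_false, hsub]
    rw [Finset.sum_eq_zero fun j hj => by rw [if_pos (hlt' j hj), zero_mul], zero_add]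
  · rw [key (fun j => (if j < k + 1 then (if j = i - (k + 2) + 1 then 1 else 0)
      else (if j - (k + 1) = i - (k + 2) + 1 then -m else 0)) * u j)]
    simp only [hlt, if_false, hsub, ite_mul, zero_mul]
    rw [Finset.sum_congr rfl fun j hj => by rw [if_pos (hlt' j hj)],
      Finset.sum_ite_eq', Finset.sum_ite_eq']
    have hm : i - (k + 2) + 1 ∈ Finset.range (k + 1) := by
      rw [Finset.mem_range]; omega
    rw [if_pos hm, if_pos hm]
    ring

theorem matQ_mulVec (k : ℕ) (w : ℕ → F) (i : Fin (2 * k + 2)) :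
    (matQ F k).mulVec (fun j => w j) i =
      if (i : ℕ) < plusRows k then ∑ j ∈ Finset.range (k + 2), plusEntry F k i j * w j
      else if (i : ℕ) < k + 2 then
        ∑ j ∈ Finset.range (k + 2), minusEntry F k (i - plusRows k) j * w (k + 2 + j)
      else 0 := by
  obtain ⟨i, hi⟩ := i
  have key : ∀ f : ℕ → F, ∑ j : Fin (2 * k + 4), f j =
      ∑ j ∈ Finset.range (k + 2), f j + ∑ j ∈ Finset.range (k + 2), f (k + 2 + j) := by
    intro f
    rw [Fin.sum_univ_eq_sum_range, show 2 * k + 4 = (k + 2) + (k + 2) by ring,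
      Finset.sum_range_add]
  have hlt : ∀ j, ¬ (k + 2 + j < k + 2) := fun j => by omega
  have hsub : ∀ j, k + 2 + j - (k + 2) = j := fun j => by omega
  have hlt' : ∀ j ∈ Finset.range (k + 2), j < k + 2 := fun j hj => Finset.mem_range.1 hj
  simp only [Matrix.mulVec, dotProduct, matQ]
  split_ifs with h1 h2
  · rw [key (fun j => (if j < k + 2 then plusEntry F k i j else 0) * w j)]
    simp only [hlt, if_false, zero_mul, Finset.sum_const_zero, add_zero]
    exact Finset.sum_congr rfl fun j hj => by rw [if_pos (hlt' j hj)]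
  · rw [key (fun j => (if j < k + 2 then 0 else
      minusEntry F k (i - plusRows k) (j - (k + 2))) * w j)]
    simp only [hlt, if_false, hsub]
    rw [Finset.sum_eq_zero fun j hj => by rw [if_pos (hlt' j hj), zero_mul], zero_add]
  · simp

/-- Row `r` pairs column `r` with column `k + 1 - r`. In the middle row, where `2r = k + 1`, the two
coincide and the entry `1` is counted only once. -/
theorem sum_plusEntry {k r : ℕ} (hr : r < plusRows k) (f : ℕ → F) :
    ∑ j ∈ Finset.range (k + 2), plusEntry F k r j * f j =
      if 2 * r = k + 1 then f r else f r + f (k + 1 - r) := by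
  unfold plusRows at hr
  have h1 : r ∈ Finset.range (k + 2) := by rw [Finset.mem_range]; omega
  have h2 : k + 1 - r ∈ Finset.range (k + 2) := by rw [Finset.mem_range]; omega
  split_ifs with h
  · rw [Finset.sum_eq_single_of_mem r h1]
    · simp [plusEntry]
    · intro j _ hj
      rw [plusEntry, if_neg (by omega), zero_mul]
  · rw [Finset.sum_eq_add_of_mem r (k + 1 - r) h1 h2 (by omega)]
    · rw [plusEntry, plusEntry, if_pos (by omega), if_pos (by omega)]; ring
    · intro j _ hj
      rw [plusEntry, if_neg (by omega), zero_mul]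

theorem sum_minusEntry {k r : ℕ} (hr : 2 * r ≤ k) (f : ℕ → F) :
    ∑ j ∈ Finset.range (k + 2), minusEntry F k r j * f j = f r - f (k + 1 - r) := by
  have h1 : r ∈ Finset.range (k + 2) := by rw [Finset.mem_range]; omega
  have h2 : k + 1 - r ∈ Finset.range (k + 2) := by rw [Finset.mem_range]; omega
  rw [Finset.sum_eq_add_of_mem r (k + 1 - r) h1 h2 (by omega)]
  · rw [minusEntry, minusEntry, if_pos rfl, if_neg (by omega), if_pos (by omega)]; ring
  · intro j _ hj
    rw [minusEntry, if_neg (by omega), if_neg (by omega), zero_mul]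

/-- `V_k^+` is `W_k^+` without its last column, so padding a vector by zero in position `k + 1` lets
one formula serve both matrices. -/
theorem sum_plusEntry_of_eq_zero {k r : ℕ} (hr : r < plusRows k) (f : ℕ → F) (hf : f (k + 1) = 0) :
    ∑ j ∈ Finset.range (k + 1), plusEntry F k r j * f j =
      if 2 * r = k + 1 then f r else f r + f (k + 1 - r) := by
  rw [← sum_plusEntry hr, Finset.sum_range_succ _ (k + 1), hf, mul_zero, add_zero]

theorem sum_minusEntry_of_eq_zero {k r : ℕ} (hr : 2 * r ≤ k) (f : ℕ → F) (hf : f (k + 1) = 0) :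
    ∑ j ∈ Finset.range (k + 1), minusEntry F k r j * f j = f r - f (k + 1 - r) := by
  rw [← sum_minusEntry hr, Finset.sum_range_succ _ (k + 1), hf, mul_zero, add_zero]

/-- The vector with first half `α 0, …, α k` and second half `β 0, …, β k`. -/
def joinVec (k : ℕ) (α β : ℕ → F) (j : ℕ) : F :=
  if j < k + 1 then α j else β (j - (k + 1))

theorem matP_mulVec_joinVec (k : ℕ) (m : F) {α β : ℕ → F} (hα : α (k + 1) = 0) (hβ : β (k + 1) = 0)
    (i : Fin (2 * k + 2)) :
    (matP k m).mulVec (fun j => joinVec k α β j) i =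
      if (i : ℕ) < plusRows k then
        if 2 * (i : ℕ) = k + 1 then α i else α i + α (k + 1 - i)
      else if (i : ℕ) < k + 2 then β (i - plusRows k) - β (k + 1 - (i - plusRows k))
      else α (i - (k + 2) + 1) - m * β (i - (k + 2) + 1) := by
  have hi := i.2
  rw [matP_mulVec]
  by_cases h1 : (i : ℕ) < plusRows k
  · rw [if_pos h1, if_pos h1, ← sum_plusEntry_of_eq_zero h1 α hα]
    exact Finset.sum_congr rfl fun j hj => by rw [joinVec, if_pos (Finset.mem_range.1 hj)]
  rw [if_neg h1, if_neg h1]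
  by_cases h2 : (i : ℕ) < k + 2
  · have h3 : 2 * ((i : ℕ) - plusRows k) ≤ k := by unfold plusRows at *; omega
    rw [if_pos h2, if_pos h2, ← sum_minusEntry_of_eq_zero h3 β hβ]
    refine Finset.sum_congr rfl fun j hj => ?_
    rw [joinVec, if_neg (by omega), Nat.add_sub_cancel_left]
  · rw [if_neg h2, if_neg h2, joinVec, if_pos (by omega), joinVec, if_neg (by omega),
      Nat.add_sub_cancel_left]

/-- The second half of `stepVec k w`, as a function of `w`. -/
def stepHalf (k : ℕ) (w : ℕ → F) (j : ℕ) : F :=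
  ((w j + w (k + 1 - j)) / mOf k w + (w (k + 2 + j) - w (k + 2 + (k + 1 - j)))) / 2

/-- The quotient `mOf` is chosen to make this entry cancel, which is why the halves can be shortened
by one at each step. Because division by zero gives zero, `mOf k w ≠ 0` already says that numerator
and denominator are both nonzero. -/
theorem stepHalf_last {k : ℕ} {w : ℕ → F} (hm : mOf k w ≠ 0) : stepHalf k w (k + 1) = 0 := by
  unfold stepHalf
  have hd : w (k + 2) - w (2 * k + 3) ≠ 0 := fun h => hm (by rw [mOf, h, div_zero])
  have hn : w 0 + w (k + 1) ≠ 0 := fun h => hm (by rw [mOf, h, zero_div])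
  rw [show k + 1 - (k + 1) = 0 by omega, show k + 2 + (k + 1) = 2 * k + 3 by ring, add_zero, mOf,
    div_div_eq_mul_div, add_comm (w (k + 1)), mul_comm, mul_div_assoc, div_self hn]
  ring

variable [NeZero (2 : F)]

/-- A kernel vector `(α, β)`, padded by zeros in position `k + 1`, has `α` antisymmetric and `β`
symmetric under `r ↦ k + 1 - r`, while `α = m β` for `1 ≤ r ≤ k`. Both symmetries together give zero
when `2` and `m` are nonzero; the entries with index `0` vanish through their padded partners. -/
theorem isUnit_matP (k : ℕ) {m : F} (hm : m ≠ 0) : IsUnit (matP k m) := by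
  rw [← Matrix.mulVec_injective_iff_isUnit]
  refine (injective_iff_map_eq_zero (matP k m).mulVecLin).2 fun u hu => ?_
  replace hu : ∀ i, (matP k m).mulVec u i = 0 := fun i => congrFun hu i
  set α : ℕ → F := fun j => if h : j < k + 1 then u ⟨j, by omega⟩ else 0 with hα
  set β : ℕ → F := fun j => if h : j < k + 1 then u ⟨k + 1 + j, by omega⟩ else 0 with hβ
  have hα0 : α (k + 1) = 0 := by simp [hα]
  have hβ0 : β (k + 1) = 0 := by simp [hβ]
  have huv : u = fun j : Fin (2 * k + 2) => joinVec k α β j := by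
    funext j
    rw [joinVec]
    split_ifs with h
    · rw [hα]; dsimp only; rw [dif_pos h]
    · have := j.2
      rw [hβ]; dsimp only; rw [dif_pos (by omega)]
      congr 1; ext; simp; omega
  rw [huv] at hu
  simp only [matP_mulVec_joinVec k m hα0 hβ0] at hu
  have h2 : ∀ x : F, x + x = 0 → x = 0 := fun x hx => by
    rw [← two_mul] at hx
    exact (mul_eq_zero.1 hx).resolve_left (NeZero.ne 2)
  have hplus : ∀ r, 2 * r < k + 1 → α r + α (k + 1 - r) = 0 := fun r hr => by
    have := hu ⟨r, by omega⟩
    simpa [plusRows, show r < (k + 1) / 2 + 1 by omega, show 2 * r ≠ k + 1 by omega] using this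
  have hmid : ∀ r, 2 * r = k + 1 → α r = 0 := fun r hr => by
    have := hu ⟨r, by omega⟩
    simpa [plusRows, show r < (k + 1) / 2 + 1 by omega, hr] using this
  have hminus : ∀ r, 2 * r ≤ k → β r = β (k + 1 - r) := fun r hr => by
    have := hu ⟨plusRows k + r, by unfold plusRows; omega⟩
    rw [if_neg (by simp), if_pos (by simp [plusRows]; omega)] at this
    simpa [sub_eq_zero] using this
  have hprop : ∀ s, 1 ≤ s → s ≤ k → α s = m * β s := fun s h1 hs => by
    have := hu ⟨k + 2 + (s - 1), by omega⟩
    rw [if_neg (by simp [plusRows]; omega), if_neg (by simp)] at this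
    simpa [sub_eq_zero, Nat.sub_add_cancel h1] using this
  have hβz : ∀ r, r ≤ k → β r = 0 := by
    have hlow : ∀ r, 2 * r ≤ k → β r = 0 := fun r hr => by
      rcases Nat.eq_zero_or_pos r with rfl | h0
      · rw [hminus 0 (by omega)]; exact hβ0
      · have h3 := hplus r (by omega)
        rw [hprop r h0 (by omega), hprop (k + 1 - r) (by omega) (by omega), ← hminus r hr,
          ← mul_add] at h3
        exact h2 _ ((mul_eq_zero.1 h3).resolve_left hm)
    intro r hr
    rcases lt_trichotomy (2 * r) (k + 1) with h | h | h
    · exact hlow r (by omega)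
    · have h3 := hmid r h
      rw [hprop r (by omega) hr] at h3
      exact (mul_eq_zero.1 h3).resolve_left hm
    · have h3 := hminus (k + 1 - r) (by omega)
      rw [show k + 1 - (k + 1 - r) = r by omega] at h3
      rw [← h3]; exact hlow _ (by omega)
  have hαz : ∀ r, r ≤ k → α r = 0 := fun r hr => by
    rcases Nat.eq_zero_or_pos r with rfl | h0
    · simpa [hα0] using hplus 0 (by omega)
    · rw [hprop r h0 hr, hβz r hr, mul_zero]
  rw [huv]
  funext j
  have := j.2
  simp only [joinVec, Pi.zero_apply]
  split_ifs with h
  · exact hαz _ (by omega)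
  · exact hβz _ (by omega)

/-- The system prescribes the sums `α_r + α_{k+1-r}` and the differences `β_r - β_{k+1-r}`. With `α
= m β`, half of the sum divided by `m`, plus half of the difference, is `β_r`. -/
theorem stepVec_eq {k : ℕ} {w : ℕ → F} (hm : mOf k w ≠ 0) {j : ℕ} (hj : j < 2 * k + 2) :
    stepVec k w j = joinVec k (fun i => mOf k w * stepHalf k w i) (stepHalf k w) j := by
  have h2 : (2 : F) ≠ 0 := NeZero.ne 2
  have hlast := stepHalf_last hm
  have hsol : (matP k (mOf k w)).mulVec
      (fun j => joinVec k (fun i => mOf k w * stepHalf k w i) (stepHalf k w) j) =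
      (matQ F k).mulVec fun i => w i := by
    funext i
    have hi := i.2
    rw [matP_mulVec_joinVec k _ (by simp [hlast]) hlast, matQ_mulVec]
    have hplus : ∀ r ≤ k + 1, mOf k w * stepHalf k w r + mOf k w * stepHalf k w (k + 1 - r) =
        w r + w (k + 1 - r) := fun r hr => by
      rw [stepHalf, stepHalf, show k + 1 - (k + 1 - r) = r by omega]
      field_simp
      ring
    by_cases h1 : (i : ℕ) < plusRows k
    · rw [if_pos h1, if_pos h1, sum_plusEntry h1]
      have h3 := hplus i (by unfold plusRows at h1; omega)
      split_ifs with h4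
      · rw [show k + 1 - (i : ℕ) = i by omega, ← two_mul, ← two_mul] at h3
        exact mul_left_cancel₀ h2 h3
      · exact h3
    rw [if_neg h1, if_neg h1]
    by_cases h4 : (i : ℕ) < k + 2
    · have h3 : 2 * ((i : ℕ) - plusRows k) ≤ k := by unfold plusRows at *; omega
      rw [if_pos h4, if_pos h4, sum_minusEntry h3 (fun j => w (k + 2 + j)), stepHalf, stepHalf]
      set r := (i : ℕ) - plusRows k
      rw [show k + 1 - (k + 1 - r) = r by omega]
      field_simp
      ring
    · rw [if_neg h4, if_neg h4, sub_self]
  have hinv := (Matrix.isUnit_iff_isUnit_det _).1 (isUnit_matP k hm)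
  rw [stepVec, dif_pos hj, ← hsol, Matrix.mulVec_mulVec, Matrix.nonsing_inv_mul _ hinv,
    Matrix.one_mulVec]

theorem stepVec_fst {k : ℕ} {w : ℕ → F} (hm : mOf k w ≠ 0) {j : ℕ} (hj : j ≤ k) :
    stepVec k w j = mOf k w * stepHalf k w j := by
  rw [stepVec_eq hm (by omega), joinVec, if_pos (by omega)]

theorem stepVec_snd {k : ℕ} {w : ℕ → F} (hm : mOf k w ≠ 0) {j : ℕ} (hj : j ≤ k) :
    stepVec k w (k + 1 + j) = stepHalf k w j := by
  rw [stepVec_eq hm (by omega), joinVec, if_neg (by omega), Nat.add_sub_cancel_left]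

end LinearSystem

/-! ### Values of rational functions -/

section Values

variable {g : ℕ} {x : Option (Fin (g + 1)) → ℝ} {f h : RatFun g} {y y' : ℝ}

theorem algebraMap_ne_zero_of_aeval_ne_zero {d : Poly g} (hd : MvPolynomial.aeval x d ≠ 0) :
    algebraMap (Poly g) (RatFun g) d ≠ 0 := by
  rw [Ne, map_eq_zero_iff _ (IsFractionRing.injective (Poly g) (RatFun g))]
  rintro rfl
  simp at hd

theorem isValueAt_algebraMap (p : Poly g) :
    IsValueAt x (algebraMap (Poly g) (RatFun g) p) (MvPolynomial.aeval x p) :=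
  ⟨p, 1, by simp, by simp, by simp⟩

theorem isValueAt_natCast (n : ℕ) : IsValueAt x (n : RatFun g) n := by
  simpa using isValueAt_algebraMap (x := x) (n : Poly g)

theorem isValueAt_zero : IsValueAt x (0 : RatFun g) 0 := by
  simpa using isValueAt_natCast (x := x) 0

theorem IsValueAt.add (h1 : IsValueAt x f y) (h2 : IsValueAt x h y') :
    IsValueAt x (f + h) (y + y') := by
  obtain ⟨p, d, hd, rfl, rfl⟩ := h1
  obtain ⟨p', d', hd', rfl, rfl⟩ := h2
  refine ⟨p * d' + d * p', d * d', by simp [hd, hd'], ?_, ?_⟩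
  · rw [div_add_div _ _ (algebraMap_ne_zero_of_aeval_ne_zero hd)
      (algebraMap_ne_zero_of_aeval_ne_zero hd')]
    simp
  · rw [div_add_div _ _ hd hd']
    simp

theorem IsValueAt.mul (h1 : IsValueAt x f y) (h2 : IsValueAt x h y') :
    IsValueAt x (f * h) (y * y') := by
  obtain ⟨p, d, hd, rfl, rfl⟩ := h1
  obtain ⟨p', d', hd', rfl, rfl⟩ := h2
  exact ⟨p * p', d * d', by simp [hd, hd'], by simp [div_mul_div_comm],
    by simp [div_mul_div_comm]⟩

theorem IsValueAt.neg (h1 : IsValueAt x f y) : IsValueAt x (-f) (-y) := by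
  obtain ⟨p, d, hd, rfl, rfl⟩ := h1
  exact ⟨-p, d, hd, by simp [neg_div], by simp [neg_div]⟩

theorem IsValueAt.sub (h1 : IsValueAt x f y) (h2 : IsValueAt x h y') :
    IsValueAt x (f - h) (y - y') := by
  simpa [sub_eq_add_neg] using h1.add h2.neg

theorem IsValueAt.inv (h1 : IsValueAt x f y) (hy : y ≠ 0) : IsValueAt x f⁻¹ y⁻¹ := by
  obtain ⟨p, d, hd, rfl, rfl⟩ := h1
  exact ⟨d, p, fun h0 => hy (by rw [h0, zero_div]), by rw [inv_div], by rw [inv_div]⟩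

theorem IsValueAt.div (h1 : IsValueAt x f y) (h2 : IsValueAt x h y') (hy : y' ≠ 0) :
    IsValueAt x (f / h) (y / y') := by
  simpa [div_eq_mul_inv] using h1.mul (h2.inv hy)

theorem IsValueAt.ne_zero (h1 : IsValueAt x f y) (hy : y ≠ 0) : f ≠ 0 := by
  rintro rfl
  exact hy (h1.unique isValueAt_zero)

theorem DefinedAt.isValueAt (h1 : DefinedAt x f) : IsValueAt x f (valueAt x f) := by
  obtain ⟨y, hy⟩ := h1
  rwa [hy.valueAt_eq]

/-- The default value of `valueAt` is `0`, so a positivity statement such as `0 < mVal x n` below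
also carries the finiteness of the value. -/
theorem definedAt_of_valueAt_ne_zero (h1 : valueAt x f ≠ 0) : DefinedAt x f := by
  by_contra h0
  exact h1 (by rw [valueAt, dif_neg h0])

end Values

/-! ### The Schur–Cohn test -/

/-- The complex polynomial `B₀ x^K + B₁ x^{K-1} + ⋯ + B_K` with real coefficients. -/
def coeffPoly (B : ℕ → ℝ) (K : ℕ) : Polynomial ℂ :=
  ∑ i ∈ Finset.range (K + 1), Polynomial.C (B i : ℂ) * Polynomial.X ^ (K - i)

/-- The value of the reversed polynomial `B₀ + B₁ x + ⋯ + B_K x^K`. -/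
def revEval (B : ℕ → ℝ) (K : ℕ) (x : ℂ) : ℂ :=
  ∑ i ∈ Finset.range (K + 1), (B i : ℂ) * x ^ i

/-- All zeros of `B₀ x^K + ⋯ + B_K` lie in the open unit disc. -/
def Stable (B : ℕ → ℝ) (K : ℕ) : Prop :=
  ∀ x : ℂ, 1 ≤ ‖x‖ → (coeffPoly B K).eval x ≠ 0

theorem eval_coeffPoly (B : ℕ → ℝ) (K : ℕ) (x : ℂ) :
    (coeffPoly B K).eval x = ∑ i ∈ Finset.range (K + 1), (B i : ℂ) * x ^ (K - i) := by
  simp [coeffPoly, Polynomial.eval_finsetSum]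

theorem eval_coeffPoly_eq_sum_reflect (B : ℕ → ℝ) (K : ℕ) (x : ℂ) :
    (coeffPoly B K).eval x = ∑ i ∈ Finset.range (K + 1), (B (K - i) : ℂ) * x ^ i := by
  rw [eval_coeffPoly, ← Finset.sum_range_reflect]
  refine Finset.sum_congr rfl fun i hi => ?_
  have := Finset.mem_range.1 hi
  rw [show K + 1 - 1 - i = K - i by omega, show K - (K - i) = i by omega]

theorem revEval_eq_sum_reflect (B : ℕ → ℝ) (K : ℕ) (x : ℂ) :
    revEval B K x = ∑ i ∈ Finset.range (K + 1), (B (K - i) : ℂ) * x ^ (K - i) := by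
  rw [revEval, ← Finset.sum_range_reflect]
  rfl

theorem revEval_eq {x : ℂ} (hx : x ≠ 0) (B : ℕ → ℝ) (K : ℕ) :
    revEval B K x = x ^ K * (coeffPoly B K).eval x⁻¹ := by
  rw [revEval, eval_coeffPoly, Finset.mul_sum]
  refine Finset.sum_congr rfl fun i hi => ?_
  have hi' : i ≤ K := by have := Finset.mem_range.1 hi; omega
  have : x ^ K = x ^ i * x ^ (K - i) := by rw [← pow_add, Nat.add_sub_cancel' hi']
  rw [this, inv_pow]
  field_simp

theorem coeff_coeffPoly (B : ℕ → ℝ) (K j : ℕ) :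
    (coeffPoly B K).coeff j = if j ≤ K then (B (K - j) : ℂ) else 0 := by
  simp only [coeffPoly, Polynomial.finsetSum_coeff, Polynomial.coeff_C_mul, Polynomial.coeff_X_pow,
    mul_ite, mul_one, mul_zero]
  split_ifs with h
  · rw [Finset.sum_eq_single_of_mem (K - j) (by rw [Finset.mem_range]; omega)]
    · rw [if_pos (by omega)]
    · intro i hi hne
      have := Finset.mem_range.1 hi
      rw [if_neg (by omega)]
  · exact Finset.sum_eq_zero fun i _ => if_neg (by omega)

theorem natDegree_coeffPoly {B : ℕ → ℝ} (hB : B 0 ≠ 0) (K : ℕ) :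
    (coeffPoly B K).natDegree = K := by
  apply Polynomial.natDegree_eq_of_le_of_coeff_ne_zero
  · rw [Polynomial.natDegree_le_iff_coeff_eq_zero]
    intro N hN
    rw [coeff_coeffPoly, if_neg (by omega)]
  · simpa [coeff_coeffPoly] using hB

theorem leadingCoeff_coeffPoly {B : ℕ → ℝ} (hB : B 0 ≠ 0) (K : ℕ) :
    (coeffPoly B K).leadingCoeff = B 0 := by
  rw [Polynomial.leadingCoeff, natDegree_coeffPoly hB, coeff_coeffPoly]
  simp

theorem coeffPoly_ne_zero {B : ℕ → ℝ} (hB : B 0 ≠ 0) (K : ℕ) : coeffPoly B K ≠ 0 := by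
  rw [← Polynomial.leadingCoeff_ne_zero, leadingCoeff_coeffPoly hB]
  exact_mod_cast hB

theorem card_roots_coeffPoly {B : ℕ → ℝ} (hB : B 0 ≠ 0) (K : ℕ) :
    Multiset.card (coeffPoly B K).roots = K := by
  rw [← (IsAlgClosed.splits (coeffPoly B K)).natDegree_eq_card_roots, natDegree_coeffPoly hB]

theorem norm_eval_coeffPoly {B : ℕ → ℝ} (hB : B 0 ≠ 0) (K : ℕ) (x : ℂ) :
    ‖(coeffPoly B K).eval x‖ = |B 0| * ((coeffPoly B K).roots.map fun r => ‖x - r‖).prod := by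
  rw [(IsAlgClosed.splits (coeffPoly B K)).eval_eq_prod_roots, leadingCoeff_coeffPoly hB, norm_mul,
    Complex.norm_real, Real.norm_eq_abs]
  congr 1
  exact (map_multiset_prod (normHom : ℂ →*₀ ℝ) _).trans (by rw [Multiset.map_map]; rfl)

theorem eval_coeffPoly_conj (B : ℕ → ℝ) (K : ℕ) (x : ℂ) :
    (coeffPoly B K).eval ((starRingEnd ℂ) x) = (starRingEnd ℂ) ((coeffPoly B K).eval x) := by
  simp [eval_coeffPoly]

theorem Stable.norm_root_lt {B : ℕ → ℝ} {K : ℕ} (h : Stable B K) {r : ℂ}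
    (hr : r ∈ (coeffPoly B K).roots) : ‖r‖ < 1 := by
  by_contra! h1
  exact h r h1 (Polynomial.isRoot_of_mem_roots hr)

/-- The difference of the squares of the two sides is `(|x|² - 1)(1 - |r|²)`. -/
theorem norm_one_sub_mul_le {x r : ℂ} (hx : 1 ≤ ‖x‖) (hr : ‖r‖ ≤ 1) :
    ‖1 - r * x‖ ≤ ‖(starRingEnd ℂ) x - r‖ := by
  have h1 : 1 ≤ Complex.normSq x := by
    rw [Complex.normSq_eq_norm_sq]; exact one_le_pow₀ hx
  have h2 : Complex.normSq r ≤ 1 := by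
    rw [Complex.normSq_eq_norm_sq]; exact pow_le_one₀ (norm_nonneg _) hr
  rw [← sq_le_sq₀ (norm_nonneg _) (norm_nonneg _), ← Complex.normSq_eq_norm_sq,
    ← Complex.normSq_eq_norm_sq]
  simp only [Complex.normSq_apply] at *
  simp
  nlinarith [mul_nonneg (sub_nonneg.2 h1) (sub_nonneg.2 h2)]

/-- The reversed polynomial is `B_0 ∏ (1 - r x)` over the roots `r`. Real coefficients allow
replacing `x` by its conjugate in `B`, after which the two products are compared factor by factor.
-/
theorem Stable.norm_revEval_le {B : ℕ → ℝ} {K : ℕ} (h : Stable B K) (hB : B 0 ≠ 0) {x : ℂ}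
    (hx : 1 ≤ ‖x‖) : ‖revEval B K x‖ ≤ ‖(coeffPoly B K).eval x‖ := by
  have hx0 : x ≠ 0 := by rintro rfl; simp at hx; linarith
  have e1 : ‖(coeffPoly B K).eval x‖ = ‖(coeffPoly B K).eval ((starRingEnd ℂ) x)‖ := by
    rw [eval_coeffPoly_conj, RCLike.norm_conj]
  have e2 : ‖x ^ K‖ = ((coeffPoly B K).roots.map fun _ => ‖x‖).prod := by
    rw [Multiset.map_const', Multiset.prod_replicate, card_roots_coeffPoly hB, norm_pow]
  rw [revEval_eq hx0, norm_mul, e1, norm_eval_coeffPoly hB, norm_eval_coeffPoly hB, e2,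
    mul_left_comm, ← Multiset.prod_map_mul]
  refine mul_le_mul_of_nonneg_left ?_ (abs_nonneg _)
  refine Multiset.prod_map_le_prod_map₀ _ _ (fun r _ => by positivity) fun r hr => ?_
  rw [← norm_mul, mul_sub, mul_inv_cancel₀ hx0, mul_comm x r]
  exact norm_one_sub_mul_le hx (h.norm_root_lt hr).le

/-- `|B_K| / |B_0|` is the product of the moduli of the `K ≥ 1` roots. -/
theorem Stable.abs_last_lt {B : ℕ → ℝ} {K : ℕ} (h : Stable B K) (hB : B 0 ≠ 0) (hK : 0 < K) :
    |B K| < |B 0| := by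
  have e := norm_eval_coeffPoly hB K 0
  rw [eval_coeffPoly_eq_sum_reflect, Finset.sum_range_succ', Finset.sum_eq_zero (by simp)] at e
  simp only [tsub_zero, pow_zero, mul_one, zero_add, Complex.norm_real, Real.norm_eq_abs, zero_sub,
    norm_neg] at e
  rw [e]
  refine mul_lt_of_lt_one_right (abs_pos.2 hB) ?_
  have hcard := card_roots_coeffPoly hB K
  obtain ⟨r, s, hs⟩ : ∃ r s, (coeffPoly B K).roots = r ::ₘ s := by
    obtain ⟨r, hr⟩ := Multiset.card_pos_iff_exists_mem.1 (hcard ▸ hK)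
    exact ⟨r, Multiset.exists_cons_of_mem hr⟩
  have hlt : ∀ t ∈ (coeffPoly B K).roots, ‖t‖ < 1 := fun t ht => h.norm_root_lt ht
  rw [hs] at hlt ⊢
  rw [Multiset.map_cons, Multiset.prod_cons]
  have h1 : (s.map fun t => ‖t‖).prod ≤ (s.map fun _ => (1 : ℝ)).prod :=
    Multiset.prod_map_le_prod_map₀ _ _ (fun _ _ => norm_nonneg _)
      fun t ht => (hlt t (Multiset.mem_cons_of_mem ht)).le
  rw [Multiset.map_const', Multiset.prod_replicate, one_pow] at h1
  exact (mul_le_of_le_one_right (norm_nonneg r) h1).trans_lt (hlt r (Multiset.mem_cons_self r s))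

/-- One step of the Schur–Cohn algorithm, for a polynomial of formal degree `K`. -/
def schurStep (ρ : ℝ) (K : ℕ) (B : ℕ → ℝ) (j : ℕ) : ℝ :=
  (ρ * (B j + B (K - j)) + (B j - B (K - j))) / 2

/-- The hypothesis is the division-free form of `ρ = (B_0 - B_K) / (B_0 + B_K)`, the value that
cancels the last coefficient and so lowers the formal degree. -/
theorem schurStep_last {ρ : ℝ} {K : ℕ} {B : ℕ → ℝ} (hρ : ρ * (B 0 + B K) = B 0 - B K) :
    schurStep ρ K B K = 0 := by
  rw [schurStep, Nat.sub_self, add_comm (B K), hρ]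
  ring

theorem schurStep_zero {ρ : ℝ} {K : ℕ} {B : ℕ → ℝ} (hρ : ρ * (B 0 + B K) = B 0 - B K) :
    schurStep ρ K B 0 = B 0 - B K := by
  rw [schurStep, Nat.sub_zero, hρ]
  ring

theorem mul_eval_schurStep {ρ : ℝ} {K : ℕ} {B : ℕ → ℝ}
    (hρ : ρ * (B 0 + B (K + 1)) = B 0 - B (K + 1)) (x : ℂ) :
    x * (coeffPoly (schurStep ρ (K + 1) B) K).eval x =
      ((1 + ρ) * (coeffPoly B (K + 1)).eval x - (1 - ρ) * revEval B (K + 1) x) / 2 := by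
  have h1 : x * (coeffPoly (schurStep ρ (K + 1) B) K).eval x =
      (coeffPoly (schurStep ρ (K + 1) B) (K + 1)).eval x := by
    rw [eval_coeffPoly, eval_coeffPoly, Finset.sum_range_succ _ (K + 1), schurStep_last hρ,
      Finset.mul_sum]
    simp only [Complex.ofReal_zero, zero_mul, add_zero]
    refine Finset.sum_congr rfl fun i hi => ?_
    have := Finset.mem_range.1 hi
    rw [show K + 1 - i = K - i + 1 by omega, pow_succ]
    ring
  rw [h1, eval_coeffPoly, eval_coeffPoly, revEval_eq_sum_reflect, Finset.mul_sum, Finset.mul_sum,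
    ← Finset.sum_sub_distrib, Finset.sum_div]
  refine Finset.sum_congr rfl fun i _ => ?_
  simp only [schurStep]
  push_cast
  ring

theorem revEval_schurStep {ρ : ℝ} {K : ℕ} {B : ℕ → ℝ}
    (hρ : ρ * (B 0 + B (K + 1)) = B 0 - B (K + 1)) (x : ℂ) :
    revEval (schurStep ρ (K + 1) B) K x =
      ((1 + ρ) * revEval B (K + 1) x - (1 - ρ) * (coeffPoly B (K + 1)).eval x) / 2 := by
  have h1 : revEval (schurStep ρ (K + 1) B) K x = revEval (schurStep ρ (K + 1) B) (K + 1) x := by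
    rw [revEval, revEval, Finset.sum_range_succ _ (K + 1), schurStep_last hρ]
    simp
  rw [h1, eval_coeffPoly_eq_sum_reflect, revEval, revEval, Finset.mul_sum, Finset.mul_sum,
    ← Finset.sum_sub_distrib, Finset.sum_div]
  refine Finset.sum_congr rfl fun i _ => ?_
  simp only [schurStep]
  push_cast
  ring

theorem abs_one_sub_lt {ρ : ℝ} (h : 0 < ρ) : |1 - ρ| < 1 + ρ :=
  abs_sub_lt_iff.2 ⟨by linarith, by linarith⟩

/-- The first term strictly dominates the second, because `|1 - ρ| < 1 + ρ` for `ρ > 0`. -/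
theorem mul_sub_mul_ne_zero {ρ : ℝ} (h : 0 < ρ) {u v : ℂ} (hu : u ≠ 0) (hv : ‖v‖ ≤ ‖u‖) :
    (1 + ρ : ℂ) * u - (1 - ρ) * v ≠ 0 := by
  intro h0
  have h1 := congrArg norm (sub_eq_zero.1 h0)
  have e1 : ‖(1 + ρ : ℂ)‖ = 1 + ρ := by
    rw [← Complex.ofReal_one, ← Complex.ofReal_add, Complex.norm_of_nonneg (by linarith)]
  have e2 : ‖(1 - ρ : ℂ)‖ = |1 - ρ| := by
    rw [← Complex.ofReal_one, ← Complex.ofReal_sub, Complex.norm_real, Real.norm_eq_abs]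
  rw [norm_mul, norm_mul, e1, e2] at h1
  have h2 := norm_pos_iff.2 hu
  have h3 := abs_one_sub_lt h
  have h4 : |1 - ρ| * ‖v‖ ≤ |1 - ρ| * ‖u‖ := mul_le_mul_of_nonneg_left hv (abs_nonneg _)
  nlinarith

/-- A step of the Schur–Cohn algorithm with `|B_K| < |B_0|`, i.e. `ρ > 0`, preserves and reflects
stability. -/
theorem stable_schurStep_iff {ρ : ℝ} {K : ℕ} {B : ℕ → ℝ} (hpos : 0 < ρ) (hB : B 0 ≠ 0)
    (hne : B 0 - B (K + 1) ≠ 0) (hρ : ρ * (B 0 + B (K + 1)) = B 0 - B (K + 1)) :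
    Stable (schurStep ρ (K + 1) B) K ↔ Stable B (K + 1) := by
  constructor
  · intro h x hx h0
    have h1 := h.norm_revEval_le (by rwa [schurStep_zero hρ]) hx
    have h2 := h x hx
    have e1 := mul_eval_schurStep hρ x
    have e2 := revEval_schurStep hρ x
    rw [h0] at e1 e2
    have hx0 : x ≠ 0 := by rintro rfl; simp at hx; linarith
    -- Write `C` for the new polynomial and `*` for reversal. At a zero `x` of `B`, `e1` and `e2`
    -- read `x C(x) = -(1 - ρ) B*(x) / 2` and `C*(x) = (1 + ρ) B*(x) / 2`, hence `(1 + ρ) x C(x) +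
    -- (1 - ρ) C*(x) = 0`, against domination by the first term.
    refine mul_sub_mul_ne_zero hpos (mul_ne_zero hx0 h2)
      (v := -revEval (schurStep ρ (K + 1) B) K x) ?_ ?_
    · rw [norm_mul, norm_neg]
      exact h1.trans (le_mul_of_one_le_left (norm_nonneg _) hx)
    · rw [e1, e2]
      ring
  · intro h x hx h0
    have e1 := mul_eval_schurStep hρ x
    rw [h0, mul_zero, eq_comm, div_eq_zero_iff] at e1
    exact mul_sub_mul_ne_zero hpos (h x hx) (h.norm_revEval_le hB hx)
      (e1.resolve_right two_ne_zero)

/-! ### Self-reciprocal polynomials -/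

/-- The coefficient of `x^{2g-i}` in the self-reciprocal polynomial. -/
def coeffVal {g : ℕ} (c : Fin (g + 1) → ℝ) (i : ℕ) : ℝ := c ⟨min i (2 * g - i), by omega⟩

theorem coeffVal_zero {g : ℕ} (c : Fin (g + 1) → ℝ) : coeffVal c 0 = c 0 :=
  congrArg c (Fin.ext (by simp))

theorem coeffVal_reflect {g : ℕ} (c : Fin (g + 1) → ℝ) {i : ℕ} (hi : i ≤ 2 * g) :
    coeffVal c (2 * g - i) = coeffVal c i :=
  congrArg c (Fin.ext (by simp; omega))

theorem selfRecipPoly_eq {g : ℕ} (c : Fin (g + 1) → ℝ) :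
    selfRecipPoly c = coeffPoly (coeffVal c) (2 * g) := by
  have hlow : ∀ i, (hi : i < g) → coeffVal c i = c (Fin.castSucc ⟨i, hi⟩) := fun i hi =>
    congrArg c (Fin.ext (by simp; omega))
  have hmid : coeffVal c g = c (Fin.last g) := congrArg c (Fin.ext (by simp; omega))
  rw [coeffPoly, show 2 * g + 1 = (g + 1) + g by ring, Finset.sum_range_add, Finset.sum_range_succ,
    ← Finset.sum_range_reflect (fun x => Polynomial.C (coeffVal c (g + 1 + x) : ℂ) *
      Polynomial.X ^ (2 * g - (g + 1 + x))), selfRecipPoly, add_right_comm, ← Finset.sum_add_distrib,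
    ← Fin.sum_univ_eq_sum_range (fun i => Polynomial.C (coeffVal c i : ℂ) *
      Polynomial.X ^ (2 * g - i) + Polynomial.C (coeffVal c (g + 1 + (g - 1 - i)) : ℂ) *
      Polynomial.X ^ (2 * g - (g + 1 + (g - 1 - i)))), hmid, show 2 * g - g = g by omega]
  congr 1
  refine Finset.sum_congr rfl fun k _ => ?_
  have hk := k.2
  rw [show g + 1 + (g - 1 - (k : ℕ)) = 2 * g - k by omega, coeffVal_reflect c (by omega),
    hlow k hk, show 2 * g - (2 * g - (k : ℕ)) = k by omega]
  ring

/-- The coefficients of the derivative of the self-reciprocal polynomial, times `t`. -/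
def derivCoeff {g : ℕ} (c : Fin (g + 1) → ℝ) (t : ℝ) (i : ℕ) : ℝ :=
  coeffVal c i * ((2 * g - i) * t)

theorem coeffPoly_derivCoeff {g : ℕ} (hg : 1 ≤ g) (c : Fin (g + 1) → ℝ) (t : ℝ) :
    coeffPoly (derivCoeff c t) (2 * g - 1) =
      Polynomial.C (t : ℂ) * Polynomial.derivative (selfRecipPoly c) := by
  rw [selfRecipPoly_eq]
  ext j
  rw [Polynomial.coeff_C_mul, Polynomial.coeff_derivative, coeff_coeffPoly, coeff_coeffPoly]
  by_cases h : j ≤ 2 * g - 1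
  · rw [if_pos h, if_pos (by omega), derivCoeff, show 2 * g - 1 - j = 2 * g - (j + 1) by omega]
    push_cast [Nat.cast_sub (show j + 1 ≤ 2 * g by omega)]
    ring
  · rw [if_neg h, if_neg (by omega)]
    simp

/-- This is `2g P = x P' + (P')*`: the coefficient of `x^{2g-i}` is multiplied by `2g - i` in one
summand and, by symmetry of the coefficients, by `i` in the other. -/
theorem two_mul_eval_selfRecipPoly {g : ℕ} (hg : 1 ≤ g) (c : Fin (g + 1) → ℝ) (x : ℂ) :
    2 * g * (selfRecipPoly c).eval x =
      x * (coeffPoly (derivCoeff c 1) (2 * g - 1)).eval x +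
        revEval (derivCoeff c 1) (2 * g - 1) x := by
  have e1 : x * (coeffPoly (derivCoeff c 1) (2 * g - 1)).eval x =
      ∑ i ∈ Finset.range (2 * g + 1), (derivCoeff c 1 i : ℂ) * x ^ (2 * g - i) := by
    rw [eval_coeffPoly, Finset.sum_range_succ _ (2 * g), show 2 * g - 1 + 1 = 2 * g by omega,
      Finset.mul_sum]
    simp only [derivCoeff]
    push_cast
    rw [sub_self, zero_mul, mul_zero, zero_mul, add_zero]
    refine Finset.sum_congr rfl fun i hi => ?_
    have := Finset.mem_range.1 hi
    rw [show 2 * g - i = 2 * g - 1 - i + 1 by omega, pow_succ]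
    ring
  have e2 : revEval (derivCoeff c 1) (2 * g - 1) x =
      ∑ i ∈ Finset.range (2 * g + 1), (derivCoeff c 1 (2 * g - i) : ℂ) * x ^ (2 * g - i) := by
    rw [← Finset.sum_range_reflect, revEval, show 2 * g - 1 + 1 = 2 * g by omega,
      Finset.sum_range_succ _ (2 * g)]
    have h0 : derivCoeff c 1 (2 * g) = 0 := by simp [derivCoeff]
    rw [show 2 * g - (2 * g + 1 - 1 - 2 * g) = 2 * g by omega, h0]
    simp only [Complex.ofReal_zero, zero_mul, add_zero]
    refine Finset.sum_congr rfl fun i hi => ?_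
    have := Finset.mem_range.1 hi
    rw [show 2 * g - (2 * g + 1 - 1 - i) = i by omega]
  rw [e1, e2, selfRecipPoly_eq, eval_coeffPoly, Finset.mul_sum, ← Finset.sum_add_distrib]
  refine Finset.sum_congr rfl fun i hi => ?_
  have hi' : i ≤ 2 * g := by have := Finset.mem_range.1 hi; omega
  rw [derivCoeff, derivCoeff, coeffVal_reflect c hi']
  push_cast [Nat.cast_sub hi']
  ring

theorem eval_selfRecipPoly_eq {g : ℕ} (c : Fin (g + 1) → ℝ) {x : ℂ} (hx : x ≠ 0) :
    (selfRecipPoly c).eval x = x ^ (2 * g) * (selfRecipPoly c).eval x⁻¹ := by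
  rw [selfRecipPoly_eq, ← revEval_eq hx, revEval_eq_sum_reflect, eval_coeffPoly]
  refine Finset.sum_congr rfl fun i hi => ?_
  rw [coeffVal_reflect c (by have := Finset.mem_range.1 hi; omega)]

/-- `2 Re(x / (x - r)) - 1 = (|x|² - |r|²) / |x - r|²`. -/
theorem half_le_re_div {x r : ℂ} (hx : 1 ≤ ‖x‖) (hr : ‖r‖ = 1) (hne : x ≠ r) :
    1 / 2 ≤ (x * (1 / (x - r))).re := by
  have h1 : 1 ≤ Complex.normSq x := by
    rw [Complex.normSq_eq_norm_sq]; exact one_le_pow₀ hx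
  have h2 : Complex.normSq r = 1 := by rw [Complex.normSq_eq_norm_sq, hr, one_pow]
  have h3 : 0 < Complex.normSq (x - r) := Complex.normSq_pos.2 (sub_ne_zero.2 hne)
  rw [mul_one_div, Complex.div_re, ← add_div, le_div_iff₀ h3]
  simp only [Complex.normSq_apply, Complex.sub_re, Complex.sub_im] at *
  nlinarith

/-- All zeros of a self-reciprocal polynomial are simple and on the unit circle if and only if all
zeros of its derivative lie in the open unit disc. -/
theorem roots_on_circle_iff_stable {g : ℕ} (hg : 1 ≤ g) {c : Fin (g + 1) → ℝ} (hc : c 0 ≠ 0)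
    {t : ℝ} (ht : t ≠ 0) :
    (∀ x : ℂ, (selfRecipPoly c).IsRoot x →
        ‖x‖ = 1 ∧ (selfRecipPoly c).rootMultiplicity x = 1) ↔
      Stable (derivCoeff c t) (2 * g - 1) := by
  have hcv : coeffVal c 0 ≠ 0 := by rwa [coeffVal_zero]
  have hP0 : selfRecipPoly c ≠ 0 := by
    rw [selfRecipPoly_eq]; exact coeffPoly_ne_zero hcv _
  have hst : ∀ s : ℝ, s ≠ 0 → (Stable (derivCoeff c s) (2 * g - 1) ↔
      ∀ x : ℂ, 1 ≤ ‖x‖ → (Polynomial.derivative (selfRecipPoly c)).eval x ≠ 0) := fun s hs => by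
    simp [Stable, coeffPoly_derivCoeff hg, hs]
  have hmult : ∀ x : ℂ, (selfRecipPoly c).IsRoot x →
      ((selfRecipPoly c).rootMultiplicity x = 1 ↔
        (Polynomial.derivative (selfRecipPoly c)).eval x ≠ 0) := fun x hx => by
    have h1 := Polynomial.one_lt_rootMultiplicity_iff_isRoot hP0 (t := x)
    have h2 := (Polynomial.rootMultiplicity_pos hP0).2 hx
    constructor
    · intro h3 h4
      exact absurd (h1.2 ⟨hx, h4⟩) (by omega)
    · intro h3
      by_contra h4
      exact h3 (h1.1 (by omega)).2
  rw [hst t ht]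
  constructor
  · intro h x hx h0
    by_cases hroot : (selfRecipPoly c).IsRoot x
    · exact (hmult x hroot).1 (h x hroot).2 h0
    -- A zero of `P'` with `|x| ≥ 1` that is not a zero of `P` would make `x P'(x) / P(x) = ∑ x / (x
    -- - r)` vanish, but its real part is at least `2g · 1/2`.
    have e := (IsAlgClosed.splits (selfRecipPoly c)).eval_derivative_div_eval_of_ne_zero hroot
    rw [h0, zero_div] at e
    have h1 : ((selfRecipPoly c).roots.map fun _ => (1 / 2 : ℝ)).sum ≤
        ((selfRecipPoly c).roots.map fun r => (x * (1 / (x - r))).re).sum := by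
      refine Multiset.sum_map_le_sum_map _ _ fun r hr => ?_
      have hr' := Polynomial.isRoot_of_mem_roots hr
      exact half_le_re_div hx (h r hr').1 (by rintro rfl; exact hroot hr')
    have h2 : ((selfRecipPoly c).roots.map fun r => (x * (1 / (x - r))).re).sum = 0 := by
      have := congrArg (fun y => Complex.reAddGroupHom (x * y)) e
      simp only [mul_zero, map_zero] at this
      rw [← Multiset.sum_map_mul_left, map_multiset_sum, Multiset.map_map] at this
      exact this.symm
    rw [h2, Multiset.map_const', Multiset.sum_replicate, selfRecipPoly_eq,
      card_roots_coeffPoly hcv, nsmul_eq_mul] at h1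
    have : (1 : ℝ) ≤ g := by exact_mod_cast hg
    push_cast at h1
    linarith
  · intro h
    have hs := (hst 1 one_ne_zero).2 h
    have hB : derivCoeff c 1 0 ≠ 0 := by
      have : (g : ℝ) ≠ 0 := by exact_mod_cast (by omega : g ≠ 0)
      simp [derivCoeff, hcv, this]
    -- At a zero of `P` outside the closed disc, `x P'(x) = -(P')*(x)`, whereas stability gives
    -- `|(P')*(x)| ≤ |P'(x)| < |x P'(x)|`.
    have hout : ∀ x : ℂ, 1 < ‖x‖ → (selfRecipPoly c).eval x ≠ 0 := fun x hx h0 => by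
      have e := two_mul_eval_selfRecipPoly hg c x
      rw [h0, mul_zero, eq_comm, add_eq_zero_iff_eq_neg] at e
      have h1 := hs.norm_revEval_le hB hx.le
      have h2 := norm_pos_iff.2 (hs x hx.le)
      have h3 := congrArg norm e
      rw [norm_neg, norm_mul] at h3
      nlinarith
    intro x hx
    have hnorm : ‖x‖ = 1 := by
      -- A zero inside the disc is not `0`, the constant term being `c_0`, and by self-reciprocity
      -- its inverse is a zero outside.
      refine le_antisymm (not_lt.1 fun h1 => hout x h1 hx) (not_lt.1 fun h1 => ?_)
      by_cases hx0 : x = 0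
      · subst hx0
        have e : (selfRecipPoly c).eval 0 = coeffVal c 0 := by
          rw [← Polynomial.coeff_zero_eq_eval_zero, selfRecipPoly_eq, coeff_coeffPoly,
            if_pos (Nat.zero_le _), coeffVal_reflect c (Nat.zero_le _)]
        rw [Polynomial.IsRoot, e] at hx
        exact hcv (by exact_mod_cast hx)
      · have h2 : 1 < ‖x⁻¹‖ := by
          rw [norm_inv]; exact (one_lt_inv₀ (norm_pos_iff.2 hx0)).2 h1
        have e := eval_selfRecipPoly_eq c hx0
        rw [hx.eq_zero, eq_comm, mul_eq_zero] at e
        exact hout _ h2 (e.resolve_left (pow_ne_zero _ hx0))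
    exact ⟨hnorm, (hmult x hx).2 (h x hnorm.ge)⟩

section Recursion

/-! ### The recursion for the values -/

theorem stable_congr {B B' : ℕ → ℝ} {K : ℕ} (h : ∀ j ≤ K, B j = B' j) :
    Stable B K ↔ Stable B' K := by
  have : coeffPoly B K = coeffPoly B' K := Finset.sum_congr rfl fun i hi => by
    rw [h i (by have := Finset.mem_range.1 hi; omega)]
  rw [Stable, Stable, this]

/-- The second half of the vector `v_g(n)`. -/
def halfVec (g n j : ℕ) : RatFun g := vVec g n (2 * g - n + 1 + j)

variable {g : ℕ}

/-- The value of `m_{2g-n}` at the point `x`. -/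
def mVal (x : Option (Fin (g + 1)) → ℝ) (n : ℕ) : ℝ := valueAt x (mRat g n)

/-- The value of the second half of `v_g(n)` at the point `x`. -/
def halfVal (x : Option (Fin (g + 1)) → ℝ) (n j : ℕ) : ℝ := valueAt x (halfVec g n j)

/-- The value of `m_{2g-n}` is positive, the vector `v_g(n)` has finite values, its first half is
`m_{2g-n}` times its second half, and the latter has a nonvanishing leading entry. -/
structure Regular (x : Option (Fin (g + 1)) → ℝ) (n : ℕ) : Prop where
  mVal_pos : 0 < mVal x n
  definedAt : ∀ j ≤ 2 * g - n, DefinedAt x (halfVec g n j)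
  proportional : ∀ j ≤ 2 * g - n, vVec g n j = mRat g n * halfVec g n j
  lead_ne_zero : halfVal x n 0 ≠ 0

variable {x : Option (Fin (g + 1)) → ℝ} {n : ℕ}

theorem isValueAt_mRat (h : 0 < mVal x n) : IsValueAt x (mRat g n) (mVal x n) :=
  (definedAt_of_valueAt_ne_zero h.ne').isValueAt

theorem Regular.isValueAt_halfVec (h : Regular x n) {j : ℕ} (hj : j ≤ 2 * g - n) :
    IsValueAt x (halfVec g n j) (halfVal x n j) :=
  (h.definedAt j hj).isValueAt

theorem Regular.isValueAt_vVec (h : Regular x n) {j : ℕ} (hj : j ≤ 2 * g - n) :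
    IsValueAt x (vVec g n j) (mVal x n * halfVal x n j) := by
  rw [h.proportional j hj]
  exact (isValueAt_mRat h.mVal_pos).mul (h.isValueAt_halfVec hj)

theorem mRat_succ (g n : ℕ) : mRat g (n + 1) = mOf (2 * g - (n + 1)) (vVec g n) := rfl

theorem vVec_zero (g : ℕ) : vVec g 0 = initVec g := rfl

theorem vVec_succ_fst (hm : mRat g (n + 1) ≠ 0) {j : ℕ} (hj : j ≤ 2 * g - (n + 1)) :
    vVec g (n + 1) j = mRat g (n + 1) * halfVec g (n + 1) j := by
  rw [mRat_succ] at *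
  exact (stepVec_fst hm hj).trans (by rw [← stepVec_snd hm hj]; rfl)

theorem halfVec_succ (hm : mRat g (n + 1) ≠ 0) {j : ℕ} (hj : j ≤ 2 * g - (n + 1)) :
    halfVec g (n + 1) j = stepHalf (2 * g - (n + 1)) (vVec g n) j :=
  stepVec_snd hm hj

theorem Regular.isValueAt_mRat_succ (h : Regular x n) (hn : n < 2 * g)
    (hne : halfVal x n 0 - halfVal x n (2 * g - n) ≠ 0) :
    IsValueAt x (mRat g (n + 1)) (mVal x n * (halfVal x n 0 + halfVal x n (2 * g - n)) /
      (halfVal x n 0 - halfVal x n (2 * g - n))) := by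
  have hm := mRat_succ g n
  rw [mOf, show 2 * g - (n + 1) + 1 = 2 * g - n by omega,
    show 2 * g - (n + 1) + 2 = 2 * g - n + 1 + 0 by omega,
    show 2 * (2 * g - (n + 1)) + 3 = 2 * g - n + 1 + (2 * g - n) by omega] at hm
  rw [hm, mul_add]
  exact ((h.isValueAt_vVec (Nat.zero_le _)).add (h.isValueAt_vVec le_rfl)).div
    ((h.isValueAt_halfVec (Nat.zero_le _)).sub (h.isValueAt_halfVec le_rfl)) hne

/-- Here the value of the denominator of `m` is not yet known to be nonzero, so the formula for `m`
is cleared of denominators among rational functions before it is evaluated. -/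
theorem Regular.mVal_succ_mul (h : Regular x n) (hn : n < 2 * g) (hpos : 0 < mVal x (n + 1)) :
    mVal x n / mVal x (n + 1) * (halfVal x n 0 + halfVal x n (2 * g - n)) =
      halfVal x n 0 - halfVal x n (2 * g - n) := by
  have h0 : mRat g (n + 1) ≠ 0 := (isValueAt_mRat hpos).ne_zero hpos.ne'
  have hm := mRat_succ g n
  rw [mOf, show 2 * g - (n + 1) + 1 = 2 * g - n by omega,
    show 2 * g - (n + 1) + 2 = 2 * g - n + 1 + 0 by omega,
    show 2 * (2 * g - (n + 1)) + 3 = 2 * g - n + 1 + (2 * g - n) by omega] at hm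
  have hd : vVec g n (2 * g - n + 1 + 0) - vVec g n (2 * g - n + 1 + (2 * g - n)) ≠ 0 := fun hd =>
    h0 (by rw [hm, hd, div_zero])
  rw [eq_div_iff hd] at hm
  have e1 := (isValueAt_mRat hpos).mul
    ((h.isValueAt_halfVec (Nat.zero_le _)).sub (h.isValueAt_halfVec le_rfl))
  have e2 := (h.isValueAt_vVec (Nat.zero_le _)).add (h.isValueAt_vVec le_rfl)
  rw [← hm] at e2
  have e3 := e1.unique e2
  field_simp
  linarith

/-- For a vector of the form `(m b, b)` the formula `stepHalf` is a Schur–Cohn step on `b`, with `ρ`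
the quotient of the old `m` by the new one. -/
theorem Regular.isValueAt_halfVec_succ (h : Regular x n) (hpos : 0 < mVal x (n + 1))
    (hn : n < 2 * g) {j : ℕ} (hj : j ≤ 2 * g - (n + 1)) :
    IsValueAt x (halfVec g (n + 1) j)
      (schurStep (mVal x n / mVal x (n + 1)) (2 * g - n) (halfVal x n) j) := by
  have hm := isValueAt_mRat hpos
  rw [halfVec_succ (hm.ne_zero hpos.ne') hj, stepHalf, ← mRat_succ,
    show 2 * g - (n + 1) + 1 = 2 * g - n by omega,
    show 2 * g - (n + 1) + 2 = 2 * g - n + 1 by omega, schurStep,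
    div_mul_eq_mul_div, mul_add]
  have h2 : IsValueAt x (2 : RatFun g) 2 := by exact_mod_cast isValueAt_natCast (x := x) 2
  exact ((((h.isValueAt_vVec (by omega)).add (h.isValueAt_vVec (by omega))).div hm hpos.ne').add
    ((h.isValueAt_halfVec (by omega)).sub (h.isValueAt_halfVec (by omega)))).div h2 two_ne_zero

theorem Regular.halfVal_succ (h : Regular x n) (hpos : 0 < mVal x (n + 1))
    (hn : n < 2 * g) {j : ℕ} (hj : j ≤ 2 * g - (n + 1)) :
    halfVal x (n + 1) j =
      schurStep (mVal x n / mVal x (n + 1)) (2 * g - n) (halfVal x n) j :=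
  (h.isValueAt_halfVec_succ hpos hn hj).valueAt_eq

theorem Regular.sub_last_ne_zero (h : Regular x n) (hpos : 0 < mVal x (n + 1)) (hn : n < 2 * g) :
    halfVal x n 0 - halfVal x n (2 * g - n) ≠ 0 := by
  intro h0
  have h1 := h.mVal_succ_mul hn hpos
  rw [h0, mul_eq_zero] at h1
  have h2 := h1.resolve_left (div_pos h.mVal_pos hpos).ne'
  exact h.lead_ne_zero (by linarith)

theorem Regular.succ (h : Regular x n) (hpos : 0 < mVal x (n + 1)) (hn : n < 2 * g) :
    Regular x (n + 1) where
  mVal_pos := hpos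
  definedAt j hj := ⟨_, h.isValueAt_halfVec_succ hpos hn hj⟩
  proportional j hj := vVec_succ_fst ((isValueAt_mRat hpos).ne_zero hpos.ne') hj
  lead_ne_zero := by
    rw [h.halfVal_succ hpos hn (Nat.zero_le _), schurStep_zero (h.mVal_succ_mul hn hpos)]
    exact h.sub_last_ne_zero hpos hn

theorem Regular.stable_succ_iff (h : Regular x n) (hpos : 0 < mVal x (n + 1)) (hn : n < 2 * g) :
    Stable (halfVal x (n + 1)) (2 * g - (n + 1)) ↔ Stable (halfVal x n) (2 * g - n) := by
  have h1 := h.mVal_succ_mul hn hpos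
  have h2 := h.sub_last_ne_zero hpos hn
  rw [stable_congr fun j hj => h.halfVal_succ hpos hn hj]
  obtain ⟨K, hK⟩ : ∃ K, 2 * g - n = K + 1 := ⟨2 * g - n - 1, by omega⟩
  rw [hK] at h1 h2 ⊢
  rw [show 2 * g - (n + 1) = K by omega]
  exact stable_schurStep_iff (div_pos h.mVal_pos hpos) h.lead_ne_zero h2 h1

/-- Stability gives `|b_K| < |b_0|`, so `b_0 + b_K` and `b_0 - b_K` have the same sign and their
quotient is positive. -/
theorem Regular.mVal_succ_pos (h : Regular x n) (hn : n < 2 * g)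
    (hst : Stable (halfVal x n) (2 * g - n)) : 0 < mVal x (n + 1) := by
  have h1 := hst.abs_last_lt h.lead_ne_zero (by omega)
  have h2 := sq_lt_sq.2 h1
  have h3 : 0 < (halfVal x n 0 + halfVal x n (2 * g - n)) *
      (halfVal x n 0 - halfVal x n (2 * g - n)) := by nlinarith
  have h4 := h.isValueAt_mRat_succ hn (right_ne_zero_of_mul h3.ne')
  rw [mVal, h4.valueAt_eq, mul_div_assoc]
  exact mul_pos h.mVal_pos (div_pos_iff.2 (mul_pos_iff.1 h3))

/-! ### The initial vector -/

section Initial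

variable {c : Fin (g + 1) → ℝ} {q : ℝ}

theorem isValueAt_initVec_fst {j : ℕ} (hj : j ≤ 2 * g) :
    IsValueAt (point c q) (initVec g j) (coeffVal c j) := by
  rw [initVec, if_pos (by omega)]
  simpa [point, coeffVal, coeffVar] using isValueAt_algebraMap (x := point c q)
    (MvPolynomial.X (some ⟨min j (2 * g - j), by omega⟩) : Poly g)

theorem isValueAt_initVec_snd {j : ℕ} (hj : j ≤ 2 * g) :
    IsValueAt (point c q) (initVec g (2 * g + 1 + j))
      (coeffVal c j * ((g - j) * Real.log q)) := by
  have h1 := isValueAt_initVec_fst (c := c) (q := q) hj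
  have h2 : IsValueAt (point c q) (logVar g) (Real.log q) := by
    simpa [point, logVar] using isValueAt_algebraMap (x := point c q) (MvPolynomial.X none : Poly g)
  rw [initVec, if_pos (by omega)] at h1
  rw [initVec, if_neg (by omega), if_pos (by omega), Nat.add_sub_cancel_left]
  exact h1.mul (((isValueAt_natCast g).sub (isValueAt_natCast j)).mul h2)

variable (hg : 1 ≤ g) (hq : 1 < q) (hc : c 0 ≠ 0)
include hg hq hc

/-- The vector `v_g(0)` is not of the form `(m b, b)`, so the first step is computed by hand; here
`γ_0 = γ_{2g} = c_0` gives `2 c_0 / (2 c_0 g log q)`. -/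
theorem isValueAt_mRat_one : IsValueAt (point c q) (mRat g 1) (1 / (g * Real.log q)) := by
  have hL := Real.log_pos hq
  have hg' : (0 : ℝ) < g := by exact_mod_cast hg
  have h0 : coeffVal c 0 ≠ 0 := by rwa [coeffVal_zero]
  have hm := mRat_succ g 0
  rw [mOf, show 2 * g - (0 + 1) + 1 = 2 * g by omega,
    show 2 * g - (0 + 1) + 2 = 2 * g + 1 + 0 by omega,
    show 2 * (2 * g - (0 + 1)) + 3 = 2 * g + 1 + 2 * g by omega, vVec_zero] at hm
  rw [hm]
  have e1 := coeffVal_reflect c (Nat.zero_le (2 * g))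
  rw [Nat.sub_zero] at e1
  have h2 : coeffVal c 0 * ((g - (0 : ℕ)) * Real.log q) -
      coeffVal c (2 * g) * ((g - (2 * g : ℕ)) * Real.log q) =
      2 * coeffVal c 0 * (g * Real.log q) := by
    rw [e1]; push_cast; ring
  have h3 := ((isValueAt_initVec_fst (c := c) (q := q) (Nat.zero_le (2 * g))).add
    (isValueAt_initVec_fst le_rfl)).div
    ((isValueAt_initVec_snd (Nat.zero_le (2 * g))).sub (isValueAt_initVec_snd le_rfl))
    (by rw [h2]; positivity)
  rw [h2, e1] at h3
  convert h3 using 1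
  field_simp
  norm_num

theorem mVal_one : mVal (point c q) 1 = 1 / (g * Real.log q) :=
  (isValueAt_mRat_one hg hq hc).valueAt_eq

theorem mVal_one_pos : 0 < mVal (point c q) 1 := by
  have hL := Real.log_pos hq
  have hg' : (0 : ℝ) < g := by exact_mod_cast hg
  rw [mVal_one hg hq hc]
  positivity

/-- The sum part contributes `γ_j g log q` and the difference part `γ_j (g - j) log q`, together a
coefficient of `log q · P_g'`. -/
theorem isValueAt_halfVec_one {j : ℕ} (hj : j ≤ 2 * g - 1) :
    IsValueAt (point c q) (halfVec g 1 j) (derivCoeff c (Real.log q) j) := by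
  have hL := Real.log_pos hq
  have hg' : (0 : ℝ) < g := by exact_mod_cast hg
  have hm := isValueAt_mRat_one hg hq hc
  have hpos : 1 / (g * Real.log q) ≠ 0 := by positivity
  rw [halfVec_succ (hm.ne_zero hpos) hj, stepHalf, ← mRat_succ,
    show 2 * g - (0 + 1) + 1 = 2 * g by omega,
    show 2 * g - (0 + 1) + 2 = 2 * g + 1 by omega, vVec_zero]
  have h2 : IsValueAt (point c q) (2 : RatFun g) 2 := by
    exact_mod_cast isValueAt_natCast (x := point c q) 2
  have h3 := ((((isValueAt_initVec_fst (c := c) (q := q) (show j ≤ 2 * g by omega)).add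
    (isValueAt_initVec_fst (show 2 * g - j ≤ 2 * g by omega))).div hm hpos).add
    ((isValueAt_initVec_snd (show j ≤ 2 * g by omega)).sub
      (isValueAt_initVec_snd (show 2 * g - j ≤ 2 * g by omega)))).div h2 two_ne_zero
  convert h3 using 1
  rw [coeffVal_reflect c (by omega), derivCoeff]
  push_cast [Nat.cast_sub (show j ≤ 2 * g by omega)]
  field_simp
  ring

theorem halfVal_one {j : ℕ} (hj : j ≤ 2 * g - 1) :
    halfVal (point c q) 1 j = derivCoeff c (Real.log q) j :=
  (isValueAt_halfVec_one hg hq hc hj).valueAt_eq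

theorem regular_one : Regular (point c q) 1 where
  mVal_pos := mVal_one_pos hg hq hc
  definedAt j hj := ⟨_, isValueAt_halfVec_one hg hq hc hj⟩
  proportional j hj := vVec_succ_fst
    ((isValueAt_mRat (mVal_one_pos hg hq hc)).ne_zero (mVal_one_pos hg hq hc).ne') hj
  lead_ne_zero := by
    have hL := Real.log_pos hq
    have hg' : (0 : ℝ) < g := by exact_mod_cast hg
    rw [halfVal_one hg hq hc (Nat.zero_le _), derivCoeff, coeffVal_zero]
    simp [hc, hL.ne', hg'.ne']

theorem regular_of_mVal_pos (h : ∀ n, 1 ≤ n → n ≤ 2 * g → 0 < mVal (point c q) n) {n : ℕ}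
    (h1 : 1 ≤ n) (hn : n ≤ 2 * g) : Regular (point c q) n := by
  induction n, h1 using Nat.le_induction with
  | base => exact regular_one hg hq hc
  | succ n h1 ih => exact (ih (by omega)).succ (h _ (by omega) hn) (by omega)

/-- Positivity of all `m`'s lets stability be pulled back from the last vector to the first.
Conversely, stability of one vector makes the next `m` positive, and this in turn makes the next
vector stable. -/
theorem mVal_pos_iff_stable :
    (∀ n, 1 ≤ n → n ≤ 2 * g → 0 < mVal (point c q) n) ↔
      Stable (derivCoeff c (Real.log q)) (2 * g - 1) := by
  rw [← stable_congr fun j hj => halfVal_one hg hq hc hj]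
  constructor
  · intro h
    have hreg := fun n h1 hn => regular_of_mVal_pos hg hq hc h (n := n) h1 hn
    -- The formal degree is `0` here, and a nonzero constant is stable.
    have hlast : Stable (halfVal (point c q) (2 * g)) (2 * g - 2 * g) := fun x _ => by
      have := (hreg (2 * g) (by omega) le_rfl).lead_ne_zero
      simpa [eval_coeffPoly] using this
    refine Nat.decreasingInduction'
      (P := fun n => Stable (halfVal (point c q) n) (2 * g - n)) ?_ (show 1 ≤ 2 * g by omega) hlast
    intro n hn h1 ih
    exact ((hreg n h1 hn.le).stable_succ_iff (h _ (by omega) hn) hn).1 ih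
  · intro h n h1 hn
    suffices Regular (point c q) n ∧ Stable (halfVal (point c q) n) (2 * g - n) from
      this.1.mVal_pos
    induction n, h1 using Nat.le_induction with
    | base => exact ⟨regular_one hg hq hc, h⟩
    | succ n h1 ih =>
      obtain ⟨h2, h3⟩ := ih (by omega)
      have h4 := h2.mVal_succ_pos (by omega) h3
      exact ⟨h2.succ h4 (by omega), (h2.stable_succ_iff h4 (by omega)).2 h3⟩

end Initial

end Recursion

section Solutions

variable {g : ℕ} {c : Fin (g + 1) → ℝ} {q : ℝ}

/-! ### The Hamiltonian -/

theorem one_le_stepIndex (q a : ℝ) : 1 ≤ stepIndex q a := Nat.le_add_left _ _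

theorem stepIndex_le (hq : 1 < q) {a : ℝ} (ha : a ∈ Ico 1 (q ^ g)) : stepIndex q a ≤ 2 * g := by
  have h0 : 0 < a := by linarith [ha.1]
  have h1 : Real.logb q a < g := by
    rw [Real.logb_lt_iff_lt_rpow hq h0, Real.rpow_natCast]
    exact ha.2
  have h2 : ⌊2 * Real.logb q a⌋₊ < 2 * g := by
    rw [Nat.floor_lt (by linarith [Real.logb_nonneg hq ha.1])]
    push_cast
    linarith
  rw [stepIndex]
  omega

theorem measurable_stepIndex (q : ℝ) : Measurable (stepIndex q) :=
  (Nat.measurable_floor.comp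
    ((Real.measurable_log.div_const _).const_mul 2)).add_const 1

theorem hamiltonian_eq {a : ℝ} (h : 0 < mVal (point c q) (stepIndex q a)) :
    hamiltonian c q a =
      !![(mVal (point c q) (stepIndex q a))⁻¹, 0; 0, mVal (point c q) (stepIndex q a)] := by
  have h0 : valueAt (point c q) (0 : RatFun g) = 0 := isValueAt_zero.valueAt_eq
  have h1 := ((isValueAt_mRat h).inv h.ne').valueAt_eq
  ext i j
  fin_cases i <;> fin_cases j <;> simp [hamiltonian, hMatrix, h0, h1, mVal]

/-- `H_q` is constant on the open interval with index `n`, so a single point of it where `H_q` is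
defined, positive semidefinite and nonzero decides the sign of `m`. -/
theorem mVal_pos_of_isCanonicalSystem (hq : 1 < q)
    (h : IsCanonicalSystem (hamiltonianDomain c q) (hamiltonian c q) 1 (q ^ g)) {n : ℕ}
    (h1 : 1 ≤ n) (hn : n ≤ 2 * g) : 0 < mVal (point c q) n := by
  set U : Set ℝ := Ioo (q ^ (((n : ℝ) - 1) / 2)) (q ^ ((n : ℝ) / 2)) with hU
  have hn1 : (1 : ℝ) ≤ n := by exact_mod_cast h1
  have hn2 : (n : ℝ) ≤ 2 * g := by exact_mod_cast hn
  have hsub : U ∩ Ico 1 (q ^ g) = U := by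
    refine inter_eq_left.2 fun a ha => ⟨?_, ?_⟩
    · exact (Real.one_le_rpow hq.le (by linarith)).trans ha.1.le
    · rw [← Real.rpow_natCast]
      exact ha.2.trans_le (Real.rpow_le_rpow_of_exponent_le hq.le (by linarith))
  have hvol : 0 < volume (U ∩ Ico 1 (q ^ g)) := by
    rw [hsub, hU, Real.volume_Ioo, ENNReal.ofReal_pos, sub_pos]
    exact Real.rpow_lt_rpow_of_exponent_lt hq (by linarith)
  have hmono : ae (volume.restrict (U ∩ Ico 1 (q ^ g))) ≤ ae (volume.restrict (Ico 1 (q ^ g))) :=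
    ae_mono (Measure.restrict_mono inter_subset_right le_rfl)
  have hmem : ∀ᵐ a ∂(volume.restrict (U ∩ Ico 1 (q ^ g))), a ∈ U ∩ Ico 1 (q ^ g) :=
    ae_restrict_mem (measurableSet_Ioo.inter measurableSet_Ico)
  obtain ⟨a, hne, haU, haD, hpsd⟩ :=
    ((not_eventually.1 (h.not_ae_zero U isOpen_Ioo hvol)).and_eventually
      (hmem.and ((h.ae_defined.filter_mono hmono).and (h.ae_posSemidef.filter_mono hmono)))).exists
  have hidx : stepIndex q a = n :=
    (stepIndex_eq_iff hq haU.2.1 n).2 ⟨haU.1.1.le, haU.1.2⟩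
  have hd0 : DefinedAt (point c q) (mRat g n)⁻¹ := by
    simpa [hMatrix, hidx] using haD.2 0 0
  have hd1 : DefinedAt (point c q) (mRat g n) := by
    simpa [hMatrix, hidx] using haD.2 1 1
  have hnonneg : 0 ≤ mVal (point c q) n := by
    have := hpsd.diag_nonneg (i := 1)
    simpa [hamiltonian, hMatrix, hidx, mVal] using this
  refine lt_of_le_of_ne hnonneg fun h0 => ?_
  have h0' : valueAt (point c q) (0 : RatFun g) = 0 := isValueAt_zero.valueAt_eq
  -- If `m` is the zero rational function then, as `0⁻¹ = 0`, both diagonal entries vanish, against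
  -- the choice of `a`. Otherwise `m` and `m⁻¹` have finite values with product `1`.
  by_cases hm : mRat g n = 0
  · refine hne ?_
    ext i j
    fin_cases i <;> fin_cases j <;> simp [hamiltonian, hMatrix, hidx, hm, h0']
  · have e1 := hd1.isValueAt.mul hd0.isValueAt
    rw [mul_inv_cancel₀ hm] at e1
    have e2 : IsValueAt (point c q) (1 : RatFun g) 1 := by
      exact_mod_cast isValueAt_natCast (x := point c q) 1
    have e3 := e1.unique e2
    rw [show valueAt (point c q) (mRat g n) = 0 from h0.symm, zero_mul] at e3
    exact zero_ne_one e3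

theorem isCanonicalSystem_of_mVal_pos (hg : 1 ≤ g) (hq : 1 < q)
    (h : ∀ n, 1 ≤ n → n ≤ 2 * g → 0 < mVal (point c q) n) :
    IsCanonicalSystem (hamiltonianDomain c q) (hamiltonian c q) 1 (q ^ g) := by
  have hpos : ∀ a ∈ Ico 1 (q ^ g), 0 < mVal (point c q) (stepIndex q a) := fun a ha =>
    h _ (one_le_stepIndex q a) (stepIndex_le hq ha)
  refine ⟨one_lt_pow₀ hq (by omega), ?_, ?_, ?_, ?_⟩
  · filter_upwards [ae_restrict_mem measurableSet_Ico] with a ha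
    have hm := isValueAt_mRat (hpos a ha)
    refine ⟨ha, fun i j => ?_⟩
    have h0 : DefinedAt (point c q) (0 : RatFun g) := ⟨0, isValueAt_zero⟩
    have h1 : DefinedAt (point c q) (mRat g (stepIndex q a)) := ⟨_, hm⟩
    have h2 : DefinedAt (point c q) (mRat g (stepIndex q a))⁻¹ := ⟨_, hm.inv (hpos a ha).ne'⟩
    fin_cases i <;> fin_cases j <;> simpa [hMatrix]
  · filter_upwards [ae_restrict_mem measurableSet_Ico] with a ha
    have hm := hpos a ha
    have : hamiltonian c q a = Matrix.diagonal
        ![(mVal (point c q) (stepIndex q a))⁻¹, mVal (point c q) (stepIndex q a)] := by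
      rw [hamiltonian_eq hm]
      ext i j
      fin_cases i <;> fin_cases j <;> simp
    rw [this, Matrix.posSemidef_diagonal_iff]
    intro i
    fin_cases i
    · simpa using hm.le
    · exact hm.le
  · intro U hU hvol h0
    have hmeas : MeasurableSet (U ∩ Ico 1 (q ^ g)) := hU.measurableSet.inter measurableSet_Ico
    have : ∀ᵐ a ∂(volume.restrict (U ∩ Ico 1 (q ^ g))), False := by
      filter_upwards [h0, ae_restrict_mem hmeas] with a ha hmem
      rw [hamiltonian_eq (hpos a hmem.2)] at ha
      exact (hpos a hmem.2).ne' (by simpa using congrFun (congrFun ha 1) 1)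
    rw [eventually_false_iff_eq_bot, ae_eq_bot, Measure.restrict_eq_zero] at this
    exact hvol.ne' this
  · intro i j
    refine IntegrableOn.locallyIntegrableOn ?_
    set G : ℕ → ℝ := fun n =>
      (!![(mRat g n)⁻¹, 0; 0, mRat g n] : Matrix _ _ (RatFun g)).map (valueAt (point c q)) i j
    have hG : (fun a => hamiltonian c q a i j) = G ∘ stepIndex q := rfl
    rw [hG]
    refine Measure.integrableOn_of_bounded (M := ∑ n ∈ Finset.range (2 * g + 1), ‖G n‖)
      (by simp) ?_ ?_
    · exact (measurable_from_nat.comp (measurable_stepIndex q)).aestronglyMeasurable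
    · filter_upwards [ae_restrict_mem measurableSet_Ico] with a ha
      exact Finset.single_le_sum (f := fun n => ‖G n‖) (fun _ _ => norm_nonneg _)
        (Finset.mem_range.2 (Nat.lt_succ_of_le (stepIndex_le hq ha)))

/-! ### The pieces of the solution -/

/-- A symmetric weight sees only the symmetric part of a vector, which is what the rows of `V^+` and
`W^+` record; the antisymmetric version below plays the same role for `V^-` and `W^-`. -/
theorem sum_mul_eq_of_symm {K : ℕ} {f u v : ℕ → ℂ} (hf : ∀ i ≤ K, f (K - i) = f i)
    (h : ∀ i ≤ K, u i + u (K - i) = v i + v (K - i)) :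
    ∑ i ∈ Finset.range (K + 1), f i * u i = ∑ i ∈ Finset.range (K + 1), f i * v i := by
  have key : ∀ w : ℕ → ℂ, 2 * ∑ i ∈ Finset.range (K + 1), f i * w i =
      ∑ i ∈ Finset.range (K + 1), f i * (w i + w (K - i)) := fun w => by
    rw [two_mul]
    conv_lhs => arg 2; rw [← Finset.sum_range_reflect]
    rw [← Finset.sum_add_distrib]
    refine Finset.sum_congr rfl fun i hi => ?_
    rw [show K + 1 - 1 - i = K - i by omega, hf i (by have := Finset.mem_range.1 hi; omega)]
    ring
  refine mul_left_cancel₀ (two_ne_zero (α := ℂ)) ?_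
  rw [key, key]
  exact Finset.sum_congr rfl fun i hi => by
    rw [h i (by have := Finset.mem_range.1 hi; omega)]

theorem sum_mul_eq_of_antisymm {K : ℕ} {f u v : ℕ → ℂ} (hf : ∀ i ≤ K, f (K - i) = -f i)
    (h : ∀ i ≤ K, u i - u (K - i) = v i - v (K - i)) :
    ∑ i ∈ Finset.range (K + 1), f i * u i = ∑ i ∈ Finset.range (K + 1), f i * v i := by
  have key : ∀ w : ℕ → ℂ, 2 * ∑ i ∈ Finset.range (K + 1), f i * w i =
      ∑ i ∈ Finset.range (K + 1), f i * (w i - w (K - i)) := fun w => by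
    rw [two_mul]
    conv_lhs => arg 2; rw [← Finset.sum_range_reflect]
    rw [← Finset.sum_add_distrib]
    refine Finset.sum_congr rfl fun i hi => ?_
    rw [show K + 1 - 1 - i = K - i by omega, hf i (by have := Finset.mem_range.1 hi; omega)]
    ring
  refine mul_left_cancel₀ (two_ne_zero (α := ℂ)) ?_
  rw [key, key]
  exact Finset.sum_congr rfl fun i hi => by
    rw [h i (by have := Finset.mem_range.1 hi; omega)]

/-- The pair of functions `(A_q(a,z), B_q(a,z))` attached to the vector `v_g(n) = (m b, b)`. -/
def piece (g : ℕ) (q : ℝ) (n : ℕ) (m : ℝ) (b : ℕ → ℝ) (z : ℂ) (a : ℝ) : Fin 2 → ℂ :=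
  ![1 / 2 * ∑ i ∈ Finset.range (2 * g - n + 1), cFun q a ((g : ℤ) - i) z * ((m * b i : ℝ) : ℂ),
    1 / 2 * (-Complex.I) * ∑ i ∈ Finset.range (2 * g - n + 1), sFun q a ((g : ℤ) - i) z * (b i : ℂ)]

theorem Regular.abPair_eq {n : ℕ} (h : Regular (point c q) n) {a : ℝ} (ha : stepIndex q a = n)
    (z : ℂ) :
    abPair c q a z = piece g q n (mVal (point c q) n) (halfVal (point c q) n) z a := by
  have key : ∀ i ∈ Finset.range (2 * g - n + 1), valueAt (point c q) (vVec g n i) =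
      mVal (point c q) n * halfVal (point c q) n i := fun i hi =>
    (h.isValueAt_vVec (by have := Finset.mem_range.1 hi; omega)).valueAt_eq
  simp only [abPair, piece, ha]
  rw [Finset.sum_congr rfl fun i hi => by rw [key i hi]]
  rfl

theorem expFun_eq (hq : 0 < q) {a : ℝ} (ha : 0 < a) (k : ℤ) (z : ℂ) :
    expFun q a k z = Complex.exp (((k * Real.log q - Real.log a : ℝ) : ℂ) * (Complex.I * z)) := by
  have h1 : 0 < q ^ k / a := by positivity
  rw [expFun, Complex.cpow_def_of_ne_zero (by exact_mod_cast h1.ne'), ← Complex.ofReal_log h1.le,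
    Real.log_div (by positivity) ha.ne', Real.log_zpow]

theorem hasDerivAt_expFun (hq : 0 < q) {a : ℝ} (ha : 0 < a) (k : ℤ) (z : ℂ) :
    HasDerivAt (fun t => expFun q t k z) (-(Complex.I * z) / a * expFun q a k z) a := by
  have h1 : HasDerivAt (fun t : ℝ => ((k * Real.log q - Real.log t : ℝ) : ℂ) * (Complex.I * z))
      (((0 - a⁻¹ : ℝ) : ℂ) * (Complex.I * z)) a :=
    (((hasDerivAt_const a _).sub (Real.hasDerivAt_log ha.ne')).ofReal_comp).mul_const _
  have h2 := h1.cexp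
  rw [← expFun_eq hq ha] at h2
  refine (h2.congr_of_eventuallyEq ?_).congr_deriv ?_
  · filter_upwards [lt_mem_nhds ha] with t ht
    exact expFun_eq hq ht k z
  · push_cast
    ring

theorem hasDerivAt_cFun (hq : 0 < q) {a : ℝ} (ha : 0 < a) (k : ℤ) (z : ℂ) :
    HasDerivAt (fun t => cFun q t k z) (-(Complex.I * z) / a * sFun q a k z) a := by
  refine ((hasDerivAt_expFun hq ha k z).add (hasDerivAt_expFun hq ha k (-z))).congr_deriv ?_
  rw [sFun]
  ring

theorem hasDerivAt_sFun (hq : 0 < q) {a : ℝ} (ha : 0 < a) (k : ℤ) (z : ℂ) :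
    HasDerivAt (fun t => sFun q t k z) (-(Complex.I * z) / a * cFun q a k z) a := by
  refine ((hasDerivAt_expFun hq ha k z).sub (hasDerivAt_expFun hq ha k (-z))).congr_deriv ?_
  rw [cFun]
  ring

/-- The derivative prescribed by the system with Hamiltonian `diag(m⁻¹, m)`. -/
def systemDeriv (m : ℝ) (z : ℂ) (a : ℝ) (Y : Fin 2 → ℂ) : Fin 2 → ℂ :=
  ![z * m / a * Y 1, -(z / (m * a)) * Y 0]

theorem systemDeriv_spec {m : ℝ} (z : ℂ) {a : ℝ} (ha : 0 < a) (Y : Fin 2 → ℂ) :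
    -(a : ℂ) • systemDeriv m z a Y =
      z • ((!![0, -1; 1, 0] * (!![m⁻¹, 0; 0, m] : Matrix _ _ ℝ).map Complex.ofReal).mulVec Y) := by
  have ha' : (a : ℂ) ≠ 0 := by exact_mod_cast ha.ne'
  have hprod : (!![0, -1; 1, 0] * (!![m⁻¹, 0; 0, m] : Matrix _ _ ℝ).map Complex.ofReal) =
      !![0, -(m : ℂ); (m : ℂ)⁻¹, 0] := by
    ext i j
    fin_cases i <;> fin_cases j <;> simp [Matrix.mul_apply, Fin.sum_univ_two]
  rw [hprod]
  funext i
  fin_cases i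
  · simp [systemDeriv, dotProduct, Fin.sum_univ_two]
    field_simp
  · simp [systemDeriv, dotProduct, Fin.sum_univ_two]
    field_simp

theorem systemDeriv_smul (m : ℝ) (z : ℂ) (a : ℝ) (r : ℂ) (Y : Fin 2 → ℂ) :
    systemDeriv m z a (r • Y) = r • systemDeriv m z a Y := by
  funext i
  fin_cases i <;> simp [systemDeriv] <;> ring

/-- The operator `a d/da` exchanges the functions `c_k` and `s_k` up to the factor `-iz`. As the two
halves of the vector differ by the constant factor `m`, it sends `A` to `z m B` and `B` to `-(z / m)
A`. -/
theorem hasDerivAt_piece (hq : 0 < q) (n : ℕ) {m : ℝ} (hm : m ≠ 0) (b : ℕ → ℝ) (z : ℂ) {a : ℝ}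
    (ha : 0 < a) :
    HasDerivAt (piece g q n m b z) (systemDeriv m z a (piece g q n m b z a)) a := by
  have ha' : (a : ℂ) ≠ 0 := by exact_mod_cast ha.ne'
  have hm' : (m : ℂ) ≠ 0 := by exact_mod_cast hm
  rw [hasDerivAt_pi]
  intro i
  fin_cases i
  · refine ((HasDerivAt.fun_sum fun i _ => (hasDerivAt_cFun hq ha _ z).mul_const _).const_mul
      (1 / 2 : ℂ)).congr_deriv ?_
    simp only [systemDeriv, piece, Fin.zero_eta, Matrix.cons_val_zero, Matrix.cons_val_one,
      Finset.mul_sum]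
    refine Finset.sum_congr rfl fun i _ => ?_
    push_cast
    ring
  · refine ((HasDerivAt.fun_sum fun i _ => (hasDerivAt_sFun hq ha _ z).mul_const _).const_mul
      (1 / 2 * -Complex.I : ℂ)).congr_deriv ?_
    simp only [systemDeriv, piece, Fin.mk_one, Matrix.cons_val_zero, Matrix.cons_val_one,
      Finset.mul_sum]
    refine Finset.sum_congr rfl fun i _ => ?_
    push_cast
    field_simp
    linear_combination (z * cFun q a ((g : ℤ) - i) z * b i) * Complex.I_sq

/-- At the breakpoint `a = q^{n/2}` the numbers `q^{g-i} / a` and `q^{g-(2g-n-i)} / a` are inverse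
to each other. Hence the `c`'s are symmetric and the `s`'s antisymmetric there. -/
theorem expFun_reflect (hq : 0 < q) {n i : ℕ} (hn : n ≤ 2 * g) (hi : i ≤ 2 * g - n) (z : ℂ) :
    expFun q (q ^ ((n : ℝ) / 2)) ((g : ℤ) - (2 * g - n - i : ℕ)) z =
      expFun q (q ^ ((n : ℝ) / 2)) ((g : ℤ) - i) (-z) := by
  have h0 : 0 < q ^ ((n : ℝ) / 2) := by positivity
  rw [expFun_eq hq h0, expFun_eq hq h0, Real.log_rpow hq]
  congr 1
  push_cast [Nat.cast_sub hi, Nat.cast_sub hn]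
  ring

/-- A step preserves the symmetric part of the first half and the antisymmetric part of the second,
and at the breakpoint only these enter `A` and `B`. The vanishing last entry of `S` makes up for the
shorter sums. -/
theorem Regular.piece_succ_eq {n : ℕ} (h : Regular (point c q) n)
    (hpos : 0 < mVal (point c q) (n + 1)) (hq : 0 < q) (hn : n < 2 * g) (z : ℂ) :
    piece g q (n + 1) (mVal (point c q) (n + 1)) (halfVal (point c q) (n + 1)) z
        (q ^ ((n : ℝ) / 2)) =
      piece g q n (mVal (point c q) n) (halfVal (point c q) n) z (q ^ ((n : ℝ) / 2)) := by
  set a := q ^ ((n : ℝ) / 2)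
  set K := 2 * g - n with hK
  set S := schurStep (mVal (point c q) n / mVal (point c q) (n + 1)) K (halfVal (point c q) n)
    with hS
  have hlast : S K = 0 := schurStep_last (h.mVal_succ_mul hn hpos)
  have hval : ∀ i ∈ Finset.range (2 * g - (n + 1) + 1), halfVal (point c q) (n + 1) i = S i :=
    fun i hi => h.halfVal_succ hpos hn (by have := Finset.mem_range.1 hi; omega)
  have hKK : 2 * g - (n + 1) + 1 = K := by omega
  have hE : ∀ i ≤ K, ∀ w, expFun q a ((g : ℤ) - (K - i : ℕ)) w = expFun q a ((g : ℤ) - i) (-w) :=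
    fun i hi w => expFun_reflect hq hn.le hi w
  have hM := hpos.ne'
  have hlin : ∀ i ≤ K, mVal (point c q) (n + 1) * S i + mVal (point c q) (n + 1) * S (K - i) =
      mVal (point c q) n * halfVal (point c q) n i +
        mVal (point c q) n * halfVal (point c q) n (K - i) := fun i hi => by
    rw [hS, schurStep, schurStep, Nat.sub_sub_self hi]
    field_simp
    ring
  have hlin' : ∀ i ≤ K, S i - S (K - i) =
      halfVal (point c q) n i - halfVal (point c q) n (K - i) := fun i hi => by
    rw [hS, schurStep, schurStep, Nat.sub_sub_self hi]
    ring
  have e1 : ∑ i ∈ Finset.range (2 * g - (n + 1) + 1), cFun q a ((g : ℤ) - i) z *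
        ((mVal (point c q) (n + 1) * halfVal (point c q) (n + 1) i : ℝ) : ℂ) =
      ∑ i ∈ Finset.range (K + 1), cFun q a ((g : ℤ) - i) z *
        ((mVal (point c q) n * halfVal (point c q) n i : ℝ) : ℂ) := by
    rw [Finset.sum_congr rfl fun i hi => by rw [hval i hi], hKK,
      ← sum_mul_eq_of_symm (f := fun i : ℕ => cFun q a ((g : ℤ) - i) z)
        (u := fun i => ((mVal (point c q) (n + 1) * S i : ℝ) : ℂ)),
      Finset.sum_range_succ _ K, hlast]
    · simp
    · intro i hi
      simp only [cFun]
      rw [hE i hi, hE i hi, neg_neg, add_comm]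
    · intro i hi
      exact_mod_cast hlin i hi
  have e2 : ∑ i ∈ Finset.range (2 * g - (n + 1) + 1), sFun q a ((g : ℤ) - i) z *
        (halfVal (point c q) (n + 1) i : ℂ) =
      ∑ i ∈ Finset.range (K + 1), sFun q a ((g : ℤ) - i) z * (halfVal (point c q) n i : ℂ) := by
    rw [Finset.sum_congr rfl fun i hi => by rw [hval i hi], hKK,
      ← sum_mul_eq_of_antisymm (f := fun i : ℕ => sFun q a ((g : ℤ) - i) z)
        (u := fun i => (S i : ℂ)),
      Finset.sum_range_succ _ K, hlast]
    · simp
    · intro i hi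
      simp only [sFun]
      rw [hE i hi, hE i hi, neg_neg, neg_sub]
    · intro i hi
      exact_mod_cast hlin' i hi
  rw [piece, piece, e1, e2]

theorem piece_zero (g : ℕ) (hq : 0 < q) (n : ℕ) (m : ℝ) (b : ℕ → ℝ) {a : ℝ} (ha : 0 < a) :
    piece g q n m b 0 a 0 = ∑ i ∈ Finset.range (2 * g - n + 1), ((m * b i : ℝ) : ℂ) := by
  simp only [piece, Matrix.cons_val_zero, Finset.mul_sum]
  refine Finset.sum_congr rfl fun i _ => ?_
  rw [cFun, neg_zero, expFun_eq hq ha, mul_zero, mul_zero, Complex.exp_zero]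
  ring

theorem piece_last (g : ℕ) (hq : 0 < q) (m : ℝ) (b : ℕ → ℝ) (z : ℂ) :
    piece g q (2 * g) m b z (q ^ g) = ![((m * b 0 : ℝ) : ℂ), 0] := by
  have h1 : ∀ w, expFun q (q ^ g) ((g : ℤ) - (0 : ℕ)) w = 1 := fun w => by
    rw [expFun_eq hq (by positivity), Real.log_pow]
    simp
  simp only [piece, Nat.sub_self, zero_add, Finset.sum_range_one, cFun, sFun, h1]
  congr 1
  · ring
  · simp

/-! ### The value at `z = 0` -/

theorem aFun_zero (c : Fin (g + 1) → ℝ) (q : ℝ) :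
    aFun c q 0 = ∑ i ∈ Finset.range (2 * g + 1), (coeffVal c i : ℂ) := by
  simp [aFun, selfRecipPoly_eq, eval_coeffPoly]

theorem aFun_neg (hq : 0 < q) (c : Fin (g + 1) → ℝ) (z : ℂ) : aFun c q (-z) = aFun c q z := by
  have hq' : (q : ℂ) ≠ 0 := by exact_mod_cast hq.ne'
  have hx : (q : ℂ) ^ (Complex.I * z) ≠ 0 := by simp [Complex.cpow_eq_zero_iff, hq']
  have e1 : (q : ℂ) ^ (Complex.I * -z) = ((q : ℂ) ^ (Complex.I * z))⁻¹ := by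
    rw [mul_neg, Complex.cpow_neg]
  have e2 : (q : ℂ) ^ (-((g : ℂ) * Complex.I * z)) = (((q : ℂ) ^ (Complex.I * z)) ^ g)⁻¹ := by
    rw [Complex.cpow_neg, mul_assoc, Complex.cpow_nat_mul]
  have e3 : (q : ℂ) ^ (-((g : ℂ) * Complex.I * -z)) = ((q : ℂ) ^ (Complex.I * z)) ^ g := by
    rw [mul_neg, neg_neg, mul_assoc, Complex.cpow_nat_mul]
  rw [aFun, aFun, e1, e2, e3, eval_selfRecipPoly_eq c hx, two_mul, pow_add]
  have := pow_ne_zero g hx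
  field_simp

/-- Self-reciprocity makes `A_q` even, so `B_q(0) = 0` and `E_q(0) = A_q(0) = P_g(1)`. -/
theorem eFun_zero (hq : 0 < q) (c : Fin (g + 1) → ℝ) :
    eFun c q 0 = ∑ i ∈ Finset.range (2 * g + 1), (coeffVal c i : ℂ) := by
  have h1 : deriv (aFun c q) 0 = 0 := by
    have h2 := deriv_comp_neg (aFun c q) 0
    rw [funext fun z => aFun_neg hq c z, neg_zero] at h2
    exact self_eq_neg.1 h2
  rw [eFun, bFun, h1, aFun_zero]
  simp

/-! ### Gluing the pieces into a solution on `[1, q^g)` -/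

section Solution

variable (hg : 1 ≤ g) (hq : 1 < q) (hc : c 0 ≠ 0)
  (hpos : ∀ n, 1 ≤ n → n ≤ 2 * g → 0 < mVal (point c q) n)
include hg hq hc hpos

/-- At `z = 0` the first component of a piece does not depend on `a`, and consecutive pieces agree
at a breakpoint, so this sum is the same for all `n`. It is evaluated at `n = 2g` to see that
`E_q(0) ≠ 0`. -/
theorem eFun_zero_eq_sum {n : ℕ} (h1 : 1 ≤ n) (hn : n ≤ 2 * g) :
    eFun c q 0 = ∑ i ∈ Finset.range (2 * g - n + 1),
      ((mVal (point c q) n * halfVal (point c q) n i : ℝ) : ℂ) := by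
  have hq0 : 0 < q := by linarith
  induction n, h1 using Nat.le_induction with
  | base =>
    have hL := Real.log_pos hq
    have hg' : (0 : ℝ) < g := by exact_mod_cast hg
    -- The first half of `v_g(1)` is `γ_i (2g - i) / g`, whose symmetrization agrees with that of
    -- `γ_i`.
    have hsum := sum_mul_eq_of_symm (K := 2 * g) (f := fun _ => 1)
      (u := fun i => (coeffVal c i : ℂ))
      (v := fun i => ((1 / (g * Real.log q) * derivCoeff c (Real.log q) i : ℝ) : ℂ))
      (fun _ _ => rfl) fun i hi => by
        simp only [← Complex.ofReal_add]
        rw [derivCoeff, derivCoeff, coeffVal_reflect c hi]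
        push_cast [Nat.cast_sub hi]
        have h1 : (g : ℂ) ≠ 0 := by exact_mod_cast hg'.ne'
        have h2 : (Real.log q : ℂ) ≠ 0 := by exact_mod_cast hL.ne'
        field_simp
        ring
    simp only [one_mul] at hsum
    rw [eFun_zero hq0, hsum, Finset.sum_range_succ, mVal_one hg hq hc,
      show 2 * g - 1 + 1 = 2 * g by omega]
    have h0 : derivCoeff c (Real.log q) (2 * g) = 0 := by simp [derivCoeff]
    rw [h0, mul_zero, Complex.ofReal_zero, add_zero]
    refine Finset.sum_congr rfl fun i hi => ?_
    rw [halfVal_one hg hq hc (by have := Finset.mem_range.1 hi; omega)]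
  | succ n h1 ih =>
    have ha : 0 < q ^ ((n : ℝ) / 2) := by positivity
    have h2 := (regular_of_mVal_pos hg hq hc hpos h1 (by omega)).piece_succ_eq
      (hpos _ (by omega) hn) hq0 (by omega) 0
    have h3 := congrFun h2 0
    rw [piece_zero g hq0 _ _ _ ha, piece_zero g hq0 _ _ _ ha] at h3
    rw [ih (by omega), h3]

theorem eFun_zero_eq_last :
    eFun c q 0 = ((mVal (point c q) (2 * g) * halfVal (point c q) (2 * g) 0 : ℝ) : ℂ) := by
  rw [eFun_zero_eq_sum hg hq hc hpos (show 1 ≤ 2 * g by omega) le_rfl]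
  simp

theorem eFun_zero_ne_zero : eFun c q 0 ≠ 0 := by
  rw [eFun_zero_eq_last hg hq hc hpos]
  have := (regular_of_mVal_pos hg hq hc hpos (show 1 ≤ 2 * g by omega) le_rfl).lead_ne_zero
  exact_mod_cast mul_ne_zero (hpos _ (by omega) le_rfl).ne' this

theorem abDefined_of_mVal_pos {a : ℝ} (ha : a ∈ Ico 1 (q ^ g)) : abDefined c q a := by
  intro j hj
  have hn := stepIndex_le hq ha
  have hreg := regular_of_mVal_pos hg hq hc hpos (one_le_stepIndex q a) hn
  rcases Nat.lt_or_ge j (2 * g - stepIndex q a + 1) with h | h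
  · exact ⟨_, hreg.isValueAt_vVec (by omega)⟩
  · have := hreg.definedAt (j - (2 * g - stepIndex q a + 1)) (by omega)
    rwa [halfVec, Nat.add_sub_cancel' h] at this

theorem abPair_eventuallyEq_right {a : ℝ} (ha : a ∈ Ico 1 (q ^ g)) (z : ℂ) :
    (fun t => abPair c q t z) =ᶠ[𝓝[≥] a]
      piece g q (stepIndex q a) (mVal (point c q) (stepIndex q a))
        (halfVal (point c q) (stepIndex q a)) z := by
  have h1 := (stepIndex_eq_iff hq ha.1 _).1 (rfl : stepIndex q a = stepIndex q a)
  filter_upwards [Ico_mem_nhdsGE h1.2] with t ht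
  exact (regular_of_mVal_pos hg hq hc hpos (one_le_stepIndex q a)
    (stepIndex_le hq ha)).abPair_eq
    ((stepIndex_eq_iff hq (ha.1.trans ht.1) _).2 ⟨h1.1.trans ht.1, ht.2⟩) z

theorem abPair_eventuallyEq_left {a : ℝ} {n : ℕ} (h1 : 1 ≤ n) (hn : n ≤ 2 * g)
    (ha : a ∈ Ioc (q ^ (((n : ℝ) - 1) / 2)) (q ^ ((n : ℝ) / 2))) (z : ℂ) :
    (fun t => abPair c q t z) =ᶠ[𝓝[<] a]
      piece g q n (mVal (point c q) n) (halfVal (point c q) n) z := by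
  have hn1 : (1 : ℝ) ≤ n := by exact_mod_cast h1
  filter_upwards [Ico_mem_nhdsLT ha.1] with t ht
  refine (regular_of_mVal_pos hg hq hc hpos h1 hn).abPair_eq
    ((stepIndex_eq_iff hq ?_ _).2 ⟨ht.1, ht.2.trans_le ha.2⟩) z
  exact (Real.one_le_rpow hq.le (by linarith)).trans ht.1

/-- The intervals are closed on the left, so the right derivative exists even at breakpoints.
Together with continuity this is enough for the mean value inequality, hence for a Lipschitz bound.
-/
theorem hasDerivWithinAt_abPair {a : ℝ} (ha : a ∈ Ico 1 (q ^ g)) (z : ℂ) :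
    HasDerivWithinAt (fun t => abPair c q t z)
      (systemDeriv (mVal (point c q) (stepIndex q a)) z a (abPair c q a z)) (Ici a) a := by
  have hn := stepIndex_le hq ha
  have e := abPair_eventuallyEq_right hg hq hc hpos ha z
  have e0 : abPair c q a z = _ := e.self_of_nhdsWithin self_mem_Ici
  rw [e0]
  exact (hasDerivAt_piece (by linarith) _ (hpos _ (one_le_stepIndex q a) hn).ne' _ z
    (by linarith [ha.1])).hasDerivWithinAt.congr_of_eventuallyEq e e0

theorem continuousAt_abPair {a : ℝ} (ha : a ∈ Ico 1 (q ^ g)) (h1a : 1 < a) (z : ℂ) :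
    ContinuousAt (fun t => abPair c q t z) a := by
  have hq0 : 0 < q := by linarith
  have ha0 : 0 < a := by linarith
  have hn := stepIndex_le hq ha
  set n := stepIndex q a with hn_def
  have h1 : 1 ≤ n := one_le_stepIndex q a
  obtain ⟨hl, hr⟩ := (stepIndex_eq_iff hq ha.1 n).1 rfl
  have e0 : abPair c q a z = piece g q n (mVal (point c q) n) (halfVal (point c q) n) z a :=
    (abPair_eventuallyEq_right hg hq hc hpos ha z).self_of_nhdsWithin self_mem_Ici
  refine continuousAt_iff_continuous_left'_right'.2
    ⟨?_, (hasDerivWithinAt_abPair hg hq hc hpos ha z).continuousWithinAt.mono Ioi_subset_Ici_self⟩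
  -- `k` is the index of the piece just to the left of `a`: it is `n` inside an interval and `n - 1`
  -- at a breakpoint, where `1 < a` ensures `n ≥ 2`.
  obtain ⟨k, h1k, hk, hak, hval⟩ : ∃ k : ℕ, 1 ≤ k ∧ k ≤ 2 * g ∧
      a ∈ Ioc (q ^ (((k : ℝ) - 1) / 2)) (q ^ ((k : ℝ) / 2)) ∧
      abPair c q a z = piece g q k (mVal (point c q) k) (halfVal (point c q) k) z a := by
    rcases hl.lt_or_eq with hlt | heq
    · exact ⟨n, h1, hn, ⟨hlt, hr.le⟩, e0⟩
    · have hn2 : 2 ≤ n := by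
        by_contra h2
        have : n = 1 := by omega
        rw [this] at heq
        norm_num at heq
        linarith
      obtain ⟨k, hk⟩ : ∃ k, n = k + 1 := ⟨n - 1, by omega⟩
      rw [hk] at heq e0
      push_cast at heq
      rw [add_sub_cancel_right] at heq
      refine ⟨k, by omega, by omega, ⟨?_, heq.ge⟩, ?_⟩
      · rw [← heq]
        exact Real.rpow_lt_rpow_of_exponent_lt hq (by linarith)
      · rw [e0, ← heq]
        exact (regular_of_mVal_pos hg hq hc hpos (by omega) (by omega)).piece_succ_eq
          (hpos _ (by omega) (by omega)) hq0 (by omega) z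
  exact (hasDerivAt_piece hq0 k (hpos k h1k hk).ne' _ z
    ha0).continuousAt.continuousWithinAt.congr_of_eventuallyEq
    (abPair_eventuallyEq_left hg hq hc hpos h1k hk hak z) hval

theorem continuousOn_abPair (z : ℂ) :
    ContinuousOn (fun t => abPair c q t z) (Ico 1 (q ^ g)) := by
  intro a ha
  rcases ha.1.eq_or_lt with h | h
  · subst h
    exact (hasDerivWithinAt_abPair hg hq hc hpos ha z).continuousWithinAt.mono Ico_subset_Ici_self
  · exact (continuousAt_abPair hg hq hc hpos ha h z).continuousWithinAt

/-- Each of the finitely many pieces extends continuously to the compact interval `[1, q^g]`, so its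
derivative is bounded there. -/
theorem exists_bound_systemDeriv (z : ℂ) : ∃ C : ℝ, ∀ a ∈ Ico 1 (q ^ g),
    ‖systemDeriv (mVal (point c q) (stepIndex q a)) z a (abPair c q a z)‖ ≤ C := by
  have hq0 : 0 < q := by linarith
  have hbound : ∀ n : ℕ, ∃ C : ℝ, ∀ a ∈ Icc 1 (q ^ g), 1 ≤ n → n ≤ 2 * g →
      ‖systemDeriv (mVal (point c q) n) z a
        (piece g q n (mVal (point c q) n) (halfVal (point c q) n) z a)‖ ≤ C := by
    intro n
    by_cases hn : 1 ≤ n ∧ n ≤ 2 * g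
    · have hm := hpos n hn.1 hn.2
      have hp : ContinuousOn (piece g q n (mVal (point c q) n) (halfVal (point c q) n) z)
          (Icc 1 (q ^ g)) := fun a ha =>
        (hasDerivAt_piece hq0 n hm.ne' _ z (by linarith [ha.1])).continuousAt.continuousWithinAt
      have hcont : ContinuousOn (fun a => systemDeriv (mVal (point c q) n) z a
          (piece g q n (mVal (point c q) n) (halfVal (point c q) n) z a)) (Icc 1 (q ^ g)) := by
        have hid : ContinuousOn (fun a : ℝ => (a : ℂ)) (Icc 1 (q ^ g)) :=
          Complex.continuous_ofReal.continuousOn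
        have hne : ∀ a ∈ Icc (1 : ℝ) (q ^ g), (a : ℂ) ≠ 0 := fun a ha => by
          exact_mod_cast (by linarith [ha.1] : (0 : ℝ) < a).ne'
        have hm' : (mVal (point c q) n : ℂ) ≠ 0 := by exact_mod_cast hm.ne'
        rw [continuousOn_pi]
        intro i
        fin_cases i
        · exact (continuousOn_const.div hid hne).mul (continuousOn_pi.1 hp 1)
        · exact (continuousOn_const.div (continuousOn_const.mul hid)
            fun a ha => mul_ne_zero hm' (hne a ha)).neg.mul (continuousOn_pi.1 hp 0)
      obtain ⟨C, hC⟩ := isCompact_Icc.exists_bound_of_continuousOn hcont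
      exact ⟨C, fun a ha _ _ => hC a ha⟩
    · exact ⟨0, fun a _ h1 h2 => absurd ⟨h1, h2⟩ hn⟩
  choose C hC using hbound
  refine ⟨∑ n ∈ Finset.range (2 * g + 1), |C n|, fun a ha => ?_⟩
  have hn := stepIndex_le hq ha
  have h1 := one_le_stepIndex q a
  rw [(regular_of_mVal_pos hg hq hc hpos h1 hn).abPair_eq rfl z]
  refine ((hC _ a ⟨ha.1, ha.2.le⟩ h1 hn).trans (le_abs_self _)).trans ?_
  exact Finset.single_le_sum (f := fun n => |C n|) (fun _ _ => abs_nonneg _)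
    (Finset.mem_range.2 (Nat.lt_succ_of_le hn))

theorem exists_lipschitzOnWith_abPair (z : ℂ) :
    ∃ C, LipschitzOnWith C (fun t => abPair c q t z) (Ico 1 (q ^ g)) := by
  obtain ⟨C, hC⟩ := exists_bound_systemDeriv hg hq hc hpos z
  have hle : ∀ x ∈ Ico 1 (q ^ g), ∀ y ∈ Ico 1 (q ^ g), x ≤ y →
      ‖abPair c q y z - abPair c q x z‖ ≤ C * (y - x) := fun x hx y hy hxy => by
    refine norm_image_sub_le_of_norm_deriv_right_le_segment (f := fun t => abPair c q t z)
      ((continuousOn_abPair hg hq hc hpos z).mono fun t ht =>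
        ⟨hx.1.trans ht.1, ht.2.trans_lt hy.2⟩)
      (fun t ht => hasDerivWithinAt_abPair hg hq hc hpos ⟨hx.1.trans ht.1, ht.2.trans hy.2⟩ z)
      (fun t ht => hC t ⟨hx.1.trans ht.1, ht.2.trans hy.2⟩) y (right_mem_Icc.2 hxy)
  have hC0 : 0 ≤ C := (norm_nonneg _).trans (hC 1 ⟨le_rfl, one_lt_pow₀ hq (by omega)⟩)
  refine ⟨C.toNNReal, LipschitzOnWith.of_dist_le_mul fun x hx y hy => ?_⟩
  rw [Real.coe_toNNReal C hC0]
  rcases le_total x y with h | h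
  · rw [dist_comm, dist_eq_norm, dist_comm x, Real.dist_eq, abs_of_nonneg (sub_nonneg.2 h)]
    exact hle x hx y hy h
  · rw [dist_eq_norm, Real.dist_eq, abs_of_nonneg (sub_nonneg.2 h)]
    exact hle y hy x hx h

theorem hasDerivAt_abPair {a : ℝ} (ha : a ∈ Ico 1 (q ^ g))
    (hbreak : ∀ n : ℕ, q ^ (((n : ℝ) - 1) / 2) ≠ a) (z : ℂ) :
    HasDerivAt (fun t => abPair c q t z)
      (systemDeriv (mVal (point c q) (stepIndex q a)) z a (abPair c q a z)) a := by
  have h1 := (stepIndex_eq_iff hq ha.1 _).1 (rfl : stepIndex q a = stepIndex q a)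
  have hl := lt_of_le_of_ne h1.1 (hbreak _)
  have e0 : abPair c q a z = _ :=
    (abPair_eventuallyEq_right hg hq hc hpos ha z).self_of_nhdsWithin self_mem_Ici
  have e := abPair_eventuallyEq_left hg hq hc hpos (one_le_stepIndex q a) (stepIndex_le hq ha)
    ⟨hl, h1.2.le⟩ z
  have hleft : HasDerivWithinAt (fun t => abPair c q t z)
      (systemDeriv (mVal (point c q) (stepIndex q a)) z a (abPair c q a z)) (Iio a) a := by
    rw [e0]
    exact (hasDerivAt_piece (by linarith) _ (hpos _ (one_le_stepIndex q a)
      (stepIndex_le hq ha)).ne' _ z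
      (by linarith [ha.1])).hasDerivWithinAt.congr_of_eventuallyEq e e0
  have := hleft.union (hasDerivWithinAt_abPair hg hq hc hpos ha z)
  rwa [Iio_union_Ici, hasDerivWithinAt_univ] at this

theorem tendsto_abPair (z : ℂ) :
    Tendsto (fun a => abPair c q a z) (𝓝[<] (q ^ g)) (𝓝 ![eFun c q 0, 0]) := by
  have hq0 : 0 < q := by linarith
  have hcast : q ^ (((2 * g : ℕ) : ℝ) / 2) = q ^ g := by
    rw [← Real.rpow_natCast]
    congr 1
    push_cast
    ring
  have e := abPair_eventuallyEq_left hg hq hc hpos (show 1 ≤ 2 * g by omega) le_rfl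
    ⟨hcast ▸ Real.rpow_lt_rpow_of_exponent_lt hq (by linarith), hcast.ge⟩ z
  rw [eFun_zero_eq_last hg hq hc hpos, ← piece_last g hq0 _ _ z]
  refine Tendsto.congr' e.symm ?_
  exact (hasDerivAt_piece hq0 _ (hpos _ (by omega) le_rfl).ne' _ z
    (by positivity)).continuousAt.continuousWithinAt

theorem isSolution_abPair :
    IsSolution (hamiltonian c q) 1 (q ^ g) (fun a z => (eFun c q 0)⁻¹ • abPair c q a z) where
  absolutelyContinuous z b hb := by
    obtain ⟨C, hC⟩ := exists_lipschitzOnWith_abPair hg hq hc hpos z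
    have h1 : LipschitzOnWith (‖(eFun c q 0)⁻¹‖₊ * C)
        (fun a => (eFun c q 0)⁻¹ • abPair c q a z) (uIcc 1 b) := by
      refine (lipschitzWith_smul (eFun c q 0)⁻¹).comp_lipschitzOnWith (hC.mono ?_)
      rw [uIcc_of_le hb.1]
      exact fun t ht => ⟨ht.1, ht.2.trans_lt hb.2⟩
    exact h1.absolutelyContinuousOnInterval
  equation z := by
    -- The equation can fail only at the breakpoints, a countable and therefore null set.
    have hcount : (range fun n : ℕ => q ^ (((n : ℝ) - 1) / 2)).Countable := countable_range _
    filter_upwards [ae_restrict_mem measurableSet_Ico,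
      ae_restrict_of_ae (hcount.ae_notMem volume)] with a ha hbreak
    have hm := hpos _ (one_le_stepIndex q a) (stepIndex_le hq ha)
    refine ⟨_, (hasDerivAt_abPair hg hq hc hpos ha (fun n hn => hbreak ⟨n, hn⟩) z).const_smul
      (eFun c q 0)⁻¹, ?_⟩
    rw [← systemDeriv_smul, systemDeriv_spec z (by linarith [ha.1]), hamiltonian_eq hm]
  boundary z := by
    have h1 := (tendsto_abPair hg hq hc hpos z).const_smul (eFun c q 0)⁻¹
    have h2 := eFun_zero_ne_zero hg hq hc hpos
    convert h1 using 2
    simp [h2]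

end Solution

end Solutions

end SelfReciprocal

end

theorem corollary1 (g : ℕ) (hg : 1 ≤ g) (q : ℝ) (hq : 1 < q)
    (c : Fin (g + 1) → ℝ) (hc : c 0 ≠ 0) :
    (SelfReciprocal.IsCanonicalSystem (SelfReciprocal.hamiltonianDomain c q)
        (SelfReciprocal.hamiltonian c q) 1 (q ^ g) ↔
      ∀ x : ℂ, (SelfReciprocal.selfRecipPoly c).IsRoot x →
        ‖x‖ = 1 ∧ (SelfReciprocal.selfRecipPoly c).rootMultiplicity x = 1) ∧
    (SelfReciprocal.IsCanonicalSystem (SelfReciprocal.hamiltonianDomain c q)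
        (SelfReciprocal.hamiltonian c q) 1 (q ^ g) →
      SelfReciprocal.eFun c q 0 ≠ 0 ∧
      (∀ a ∈ Set.Ico (1 : ℝ) (q ^ g), SelfReciprocal.abDefined c q a) ∧
      SelfReciprocal.IsSolution (SelfReciprocal.hamiltonian c q) 1 (q ^ g)
        (fun a z => (SelfReciprocal.eFun c q 0)⁻¹ • SelfReciprocal.abPair c q a z)) := by
  constructor
  · rw [SelfReciprocal.roots_on_circle_iff_stable hg hc (Real.log_pos hq).ne',
      ← SelfReciprocal.mVal_pos_iff_stable hg hq hc]
    exact ⟨fun h n h1 hn => SelfReciprocal.mVal_pos_of_isCanonicalSystem hq h h1 hn,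
      SelfReciprocal.isCanonicalSystem_of_mVal_pos hg hq⟩
  · intro h
    have hpos := fun n h1 hn => SelfReciprocal.mVal_pos_of_isCanonicalSystem hq h (n := n) h1 hn
    exact ⟨SelfReciprocal.eFun_zero_ne_zero hg hq hc hpos,
      fun a ha => SelfReciprocal.abDefined_of_mVal_pos hg hq hc hpos ha,
      SelfReciprocal.isSolution_abPair hg hq hc hpos⟩
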